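/- For a metric space $X$, let $B(x,r)$ denote the closed ball of radius $r$ about $x$; $X$ is proper if all its closed balls are compact. For a proper metric space $X$, let $C_H(X)$ be the set of bounded continuous functions $f:X\to\mathbb{R}$ such that for all $r>0$ and $\varepsilon>0$ there is a compact $K\subset X$ with $\operatorname{diam} f(B(x,r))<\varepsilon$ for every $x\in X\setminus K$. The evaluation map $e:X\to\prod_{f\in C_H(X)}[\inf f,\sup f]$, $e(x)_f=f(x)$, is an embedding; the Higson compactification of $X$ is the closure $\overline{e(X)}$ in the product, and the Higson corona is $\nu X=\overline{e(X)}\setminus e(X)$ with the subspace topology. A continuum is a non-empty compact connected Hausdorff space. It is indecomposable if it is not the union of two proper subsets each of which is a continuum in the subspace topology. A map $f:X\to Y$ of metric spaces, not necessarily continuous, is coarse if preimages of bounded sets are bounded and there is a non-decreasing $\sigma:[0,\infty)\to[0,\infty)$ with $d_Y(f(x),f(y))\le\sigma(d_X(x,y))$ for all $x,y\in X$. The spaces $X$ and $Y$ are coarsely equivalent if there are coarse maps $f:X\to Y$ and $g:Y\to X$ such that $\sup_{x}d_X(g(f(x)),x)<\infty$ and $\sup_{y}d_Y(f(g(y)),y)<\infty$.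 A metric space is geodesic if any two of its points $x,y$ are joined by an isometrically embedded copy of the interval $[0,d(x,y)]$, and it is coarsely geodesic if it is coarsely equivalent to a geodesic metric space. A metric space $X$ has coarse bounded geometry if there are $A\subset X$, $r>0$ and $\lambda:[0,\infty)\to[0,\infty)$ such that every point of $X$ is at distance less than $r$ from some point of $A$, and $A\cap B(x,t)$ is finite with at most $\lambda(t)$ elements for all $x\in X$ and $t>0$. **Corollary 3.11.** Let $X$ be a non-compact proper metric space that is coarsely geodesic and has coarse bounded geometry. Then $\nu X$ is an indecomposable continuum if and only if $\nu X$ is homeomorphic to $\nu\mathbb{N}$, where $\mathbb{N}$ carries the metric $d(m,n)=|m-n|$. -/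

import Mathlib

open scoped NNReal BoundedContinuousFunction

namespace Coarse

universe u v

/-- Uniformly expansive maps. -/
def UniformlyExpansive {X : Type u} {Y : Type v} [MetricSpace X] [MetricSpace Y]
    (f : X → Y) : Prop :=
  ∃ σ : ℝ≥0 → ℝ≥0, Monotone σ ∧ ∀ x y : X, nndist (f x) (f y) ≤ σ (nndist x y)

/-- Metrically proper maps. -/
def MetricallyProper {X : Type u} {Y : Type v} [MetricSpace X] [MetricSpace Y]
    (f : X → Y) : Prop :=
  ∀ B : Set Y, Bornology.IsBounded B → Bornology.IsBounded (f ⁻¹' B)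

/-- Coarse maps (not necessarily continuous). -/
def IsCoarseMap {X : Type u} {Y : Type v} [MetricSpace X] [MetricSpace Y]
    (f : X → Y) : Prop :=
  UniformlyExpansive f ∧ MetricallyProper f

/-- Two maps are close if they are at bounded distance from each other. -/
def Close {X : Type u} {Y : Type v} [MetricSpace Y] (f g : X → Y) : Prop :=
  ∃ r : ℝ, 0 < r ∧ ∀ x : X, dist (f x) (g x) < r

/-- Coarse equivalences. -/
def IsCoarseEquivalence {X : Type u} {Y : Type v} [MetricSpace X] [MetricSpace Y]
    (f : X → Y) : Prop :=
  IsCoarseMap f ∧ ∃ g : Y → X, IsCoarseMap g ∧ Close (g ∘ f) id ∧ Close (f ∘ g) id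

/-- Coarsely equivalent metric spaces. -/
def CoarselyEquivalent (X : Type u) (Y : Type v) [MetricSpace X] [MetricSpace Y] : Prop :=
  ∃ f : X → Y, IsCoarseEquivalence f

/-- Geodesic metric spaces: any two points `x`, `y` are joined by an isometric image of
the interval `[0, dist x y]`. -/
def IsGeodesic (M : Type u) [MetricSpace M] : Prop :=
  ∀ x y : M, ∃ γ : ℝ → M, γ 0 = x ∧ γ (dist x y) = y ∧
    ∀ s ∈ Set.Icc 0 (dist x y), ∀ t ∈ Set.Icc 0 (dist x y), dist (γ s) (γ t) = |s - t|

/-- A metric space is coarsely geodesic if it is coarsely equivalent to a geodesic metric space. -/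
def CoarselyGeodesic (X : Type u) [MetricSpace X] : Prop :=
  ∃ (M : Type u) (_ : MetricSpace M), IsGeodesic M ∧ CoarselyEquivalent X M

/-- Nets in a metric space. -/
def IsNet {X : Type u} [MetricSpace X] (A : Set X) : Prop :=
  ∃ r : ℝ, 0 < r ∧ ∀ y : X, ∃ z ∈ A, dist y z < r

/-- Coarse bounded geometry: there is a net meeting each closed ball of radius `t` in a finite
number of points, bounded by a function of `t` alone. -/
def CoarseBoundedGeometry (X : Type u) [MetricSpace X] : Prop :=
  ∃ A : Set X, IsNet A ∧ ∃ Λ : ℝ≥0 → ℝ≥0, ∀ (x : X) (t : ℝ≥0), 0 < t →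
    (A ∩ Metric.closedBall x t).Finite ∧ ((A ∩ Metric.closedBall x t).ncard : ℝ≥0) ≤ Λ t

/-- Higson functions. -/
def IsHigsonFunction {X : Type u} {Y : Type v} [MetricSpace X] [MetricSpace Y]
    (f : X → Y) : Prop :=
  ∀ r : ℝ, 0 < r → ∀ ε : ℝ, 0 < ε → ∃ K : Set X, IsCompact K ∧
    ∀ x ∉ K, Metric.diam (f '' Metric.closedBall x r) < ε

/-- The set `C_H(X)` of bounded continuous real-valued Higson functions on `X`. -/
def higsonFunctions (X : Type u) [MetricSpace X] : Set (X →ᵇ ℝ) :=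
  {f | IsHigsonFunction (f : X → ℝ)}

/-- The product over `f ∈ C_H(X)` of the compact intervals `[inf f, sup f]`. -/
abbrev HigsonCube (X : Type u) [MetricSpace X] : Type u :=
  (f : higsonFunctions X) → Set.Icc (⨅ x : X, f.1 x) (⨆ x : X, f.1 x)

/-- The evaluation map of `C_H(X)`. -/
noncomputable def higsonEval (X : Type u) [MetricSpace X] (x : X) : HigsonCube X :=
  fun f => ⟨f.1 x, ciInf_le f.1.isBounded_range.bddBelow x,
    le_ciSup f.1.isBounded_range.bddAbove x⟩

/-- The Higson compactification of `X`, as the closure of the image of `X` in the cube. -/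
def higsonCompactification (X : Type u) [MetricSpace X] : Set (HigsonCube X) :=
  closure (Set.range (higsonEval X))

/-- The Higson corona `νX`: the Higson compactification minus (the image of) `X`,
with the subspace topology. -/
def higsonCorona (X : Type u) [MetricSpace X] : Set (HigsonCube X) :=
  higsonCompactification X \ Set.range (higsonEval X)

/-- A continuum is a non-empty compact connected Hausdorff space
(`ConnectedSpace` includes non-emptiness). -/
def IsContinuum (K : Type u) [TopologicalSpace K] : Prop :=
  CompactSpace K ∧ ConnectedSpace K ∧ T2Space K

/-- The space is a union of two proper subcontinua. -/
def IsDecomposable (K : Type u) [TopologicalSpace K] : Prop :=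
  ∃ A B : Set K, IsContinuum A ∧ IsContinuum B ∧ A ≠ Set.univ ∧ B ≠ Set.univ ∧
    A ∪ B = Set.univ

/-- A continuum that is not decomposable. -/
def IsIndecomposableContinuum (K : Type u) [TopologicalSpace K] : Prop :=
  IsContinuum K ∧ ¬ IsDecomposable K

end Coarse

namespace Coarse

open Set Filter Topology Bornology

universe u v

/-! ### The corona as a union of traces of subsets, and separation of divergent sets. -/

section Corona

variable {X : Type u} [MetricSpace X]

/-! Far out, Higson functions are nearly constant on balls of fixed radius. Hence subsets of `X`
that diverge from each other have disjoint limit sets in the corona (`Divergent.disjoint_trace`),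
and a subset that is chain connected at infinity has a connected limit set (`isPreconnected_trace`).

Why `νℕ` is indecomposable: suppose it is the union of closed sets `A` and `B`, with `p` in `A` only
and `q` in `B` only. Near `q` there are arbitrarily long intervals of integers, and they stay away
from `A`. Cutting `ℕ` at these intervals gives blocks, each containing a point near `p`. The even
and the odd blocks diverge once the intervals are removed, so their traces split `A` into two
non-empty closed parts (`not_isPreconnected_of_subset_higsonCorona_nat`). Indecomposability passes
along homeomorphisms.

Conversely, a non-compact coarsely geodesic `X` contains a coarsely embedded ray (`exists_isRay`).
If the ray is coarsely dense, it induces a homeomorphism `νℕ ≃ₜ νX`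
(`IsCoarseDenseEmbedding.nonempty_homeomorph`). If not, there are ever larger balls ever farther
from the ray, and connectedness of `νX` allows each to be joined to the ray by a chain far out. The
ray with every second such appendix has a connected trace; the balls kept give it interior, and
those omitted make it proper. A continuum with such a subcontinuum is decomposable
(`isDecomposable_of_subcontinuum`). -/

theorem continuous_higsonEval : Continuous (higsonEval X) :=
  continuous_pi fun f => f.1.continuous.subtype_mk _

theorem isHigsonFunction_of_eventually [ProperSpace X] {f : X → ℝ}
    (h : ∀ r > 0, ∀ ε > 0, ∀ᶠ x in cobounded X, ∀ y, dist y x ≤ r → dist (f y) (f x) ≤ ε) :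
    IsHigsonFunction f := by
  intro r hr ε hε
  have h1 := h r hr (ε / 3) (by positivity)
  rw [Metric.cobounded_eq_cocompact] at h1
  obtain ⟨K, hK, hKs⟩ := mem_cocompact.1 h1
  refine ⟨K, hK, fun x hx => ?_⟩
  have h2 := hKs hx
  refine (Metric.diam_le_of_forall_dist_le (C := 2 * ε / 3) (by positivity) ?_).trans_lt
    (by linarith)
  rintro _ ⟨y, hy, rfl⟩ _ ⟨z, hz, rfl⟩
  have := dist_triangle_right (f y) (f z) (f x)
  have := h2 y hy
  have := h2 z hz
  linarith

theorem eventually_dist_lt (f : higsonFunctions X) (r : ℝ) {ε : ℝ} (hε : 0 < ε) :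
    ∀ᶠ x in cobounded X, ∀ y, dist y x ≤ r → dist (f.1 y) (f.1 x) < ε := by
  -- The Higson condition needs a positive radius, while `r` is arbitrary.
  obtain ⟨K, hK, h⟩ := f.2 (max r 1) (by positivity) ε hε
  filter_upwards [isBounded_def.1 hK.isBounded] with x hx y hy
  refine (Metric.dist_le_diam_of_mem (f.1.isBounded_image _) ?_ ?_).trans_lt (h x hx)
  · exact mem_image_of_mem _ (hy.trans (le_max_left _ _))
  · exact mem_image_of_mem _ (Metric.mem_closedBall_self (by positivity))

theorem tendsto_higsonEval_iff {ι : Type*} {a : ι → X} {F : Filter ι} {z : HigsonCube X} :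
    Tendsto (fun i => higsonEval X (a i)) F (𝓝 z) ↔
      ∀ f : higsonFunctions X, Tendsto (fun i => f.1 (a i)) F (𝓝 (z f : ℝ)) := by
  rw [tendsto_pi_nhds]
  refine forall_congr' fun f => ?_
  rw [tendsto_subtype_rng]
  rfl

/-- Nets at bounded distance that go to infinity have the same limits in the cube. -/
theorem tendsto_higsonEval_of_dist_le {ι : Type*} {a b : ι → X} {F : Filter ι}
    {z : HigsonCube X} {r : ℝ} (ha : Tendsto a F (cobounded X))
    (hab : ∀ᶠ i in F, dist (b i) (a i) ≤ r)
    (h : Tendsto (fun i => higsonEval X (a i)) F (𝓝 z)) :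
    Tendsto (fun i => higsonEval X (b i)) F (𝓝 z) := by
  rw [tendsto_higsonEval_iff] at h ⊢
  intro f
  refine (h f).congr_dist ?_
  rw [Metric.tendsto_nhds]
  intro ε hε
  filter_upwards [ha.eventually (eventually_dist_lt f r hε), hab] with i h1 h2
  rw [Real.dist_0_eq_abs, abs_of_nonneg dist_nonneg, dist_comm]
  exact h1 _ h2

/-- The part of the Higson corona in the closure of a subset of the space. -/
def trace (A : Set X) : Set (HigsonCube X) :=
  {z | MapClusterPt z (cobounded X ⊓ 𝓟 A) (higsonEval X)}

theorem isClosed_trace (A : Set X) : IsClosed (trace A) := isClosed_setOfPred_clusterPt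

theorem isCompact_trace (A : Set X) : IsCompact (trace A) := (isClosed_trace A).isCompact

theorem trace_mono {A B : Set X} (h : A ⊆ B) : trace A ⊆ trace B := fun _ hz =>
  MapClusterPt.mono hz (inf_le_inf_left _ (principal_mono.2 h))

/-- Ultrafilters take the place of sequences, since the cube need not be first countable. -/
theorem mem_trace_iff {A : Set X} {z : HigsonCube X} :
    z ∈ trace A ↔ ∃ F : Ultrafilter X, ↑F ≤ cobounded X ∧ A ∈ F ∧
      Tendsto (higsonEval X) F (𝓝 z) := by
  simp [trace, mapClusterPt_iff_ultrafilter, and_assoc]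

theorem mem_trace_of_tendsto {ι : Type*} {a : ι → X} {F : Filter ι} [NeBot F]
    {z : HigsonCube X} {A : Set X} (ha : Tendsto a F (cobounded X)) (hA : ∀ᶠ i in F, a i ∈ A)
    (h : Tendsto (fun i => higsonEval X (a i)) F (𝓝 z)) : z ∈ trace A := by
  have h1 : Tendsto a F (cobounded X ⊓ 𝓟 A) := tendsto_inf.2 ⟨ha, tendsto_principal.2 hA⟩
  exact MapClusterPt.of_comp h1 h.mapClusterPt

theorem exists_tendsto_higsonEval {ι : Type*} (a : ι → X) (F : Ultrafilter ι) :
    ∃ z, Tendsto (fun i => higsonEval X (a i)) F (𝓝 z) := by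
  obtain ⟨z, -, hz⟩ := isCompact_univ.ultrafilter_le_nhds
    (F.map fun i => higsonEval X (a i)) (by simp)
  exact ⟨z, hz⟩

theorem trace_union (A B : Set X) : trace (A ∪ B) = trace A ∪ trace B := by
  refine Subset.antisymm (fun z hz => ?_)
    (union_subset (trace_mono subset_union_left) (trace_mono subset_union_right))
  obtain ⟨F, h1, h2, h3⟩ := mem_trace_iff.1 hz
  rcases Ultrafilter.union_mem_iff.1 h2 with h | h
  · exact Or.inl (mem_trace_iff.2 ⟨F, h1, h, h3⟩)
  · exact Or.inr (mem_trace_iff.2 ⟨F, h1, h, h3⟩)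

theorem neBot_cobounded_inf_principal {A : Set X} (hA : ¬ IsBounded A) :
    NeBot (cobounded X ⊓ 𝓟 A) := by
  rw [inf_principal_neBot_iff]
  intro U hU
  by_contra h
  rw [not_nonempty_iff_eq_empty, ← disjoint_iff_inter_eq_empty] at h
  exact hA ((isBounded_compl_iff.2 (isCobounded_def.2 hU)).subset h.subset_compl_left)

theorem trace_nonempty {A : Set X} (hA : ¬ IsBounded A) : (trace A).Nonempty := by
  have := neBot_cobounded_inf_principal hA
  obtain ⟨z, hz⟩ := exists_clusterPt_of_compactSpace
    (map (higsonEval X) (cobounded X ⊓ 𝓟 A))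
  exact ⟨z, hz⟩

/-- The bump function at a point is a Higson function. -/
theorem exists_higsonFunction_bump [ProperSpace X] (x : X) :
    ∃ f : higsonFunctions X, f.1 x = 1 ∧ ∀ᶠ y in cobounded X, f.1 y = 0 := by
  let g : X →ᵇ ℝ := BoundedContinuousFunction.ofNormedAddCommGroup
    (fun y => max 0 (1 - dist y x)) (by fun_prop) 1 (fun y => by
      rw [Real.norm_eq_abs, abs_of_nonneg (le_max_left _ _)]
      exact max_le zero_le_one (by linarith [dist_nonneg (x := y) (y := x)]))
  have hg : ∀ y, 1 ≤ dist y x → g y = 0 := fun y hy =>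
    max_eq_left (by linarith)
  have hev : ∀ r : ℝ, ∀ᶠ y in cobounded X, r ≤ dist y x := fun r => by
    filter_upwards [isBounded_def.1 (Metric.isBounded_ball (x := x) (r := r))] with y hy
    simpa using hy
  refine ⟨⟨g, isHigsonFunction_of_eventually fun r hr ε hε => ?_⟩, ?_, ?_⟩
  · filter_upwards [hev (r + 1)] with y hy z hz
    rw [hg y (by linarith), hg z ?_, dist_self]
    · exact hε.le
    · have := dist_triangle_left y x z
      linarith
  · change max 0 (1 - dist x x) = 1
    simp
  · filter_upwards [hev 1] with y hy using hg y hy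

/-- By properness an ultrafilter containing a bounded set converges in `X`, so its limit in the cube
is in the image of `X`. Conversely the bump at `x` tends to `0` at infinity but equals `1` at `x`.
-/
theorem higsonCorona_eq_trace [ProperSpace X] : higsonCorona X = trace univ := by
  ext z
  constructor
  · rintro ⟨h1, h2⟩
    obtain ⟨G, hG, hz⟩ := mem_closure_iff_ultrafilter.1 h1
    let F := G.ofComapInfPrincipal (m := higsonEval X) (s := univ) (by simpa using hG)
    have hF : F.map (higsonEval X) = G := Ultrafilter.ofComapInfPrincipal_eq_of_map _
    have ht : Tendsto (higsonEval X) F (𝓝 z) := by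
      rw [Tendsto, ← Ultrafilter.coe_map, hF]; exact hz
    refine mem_trace_iff.2 ⟨F, fun s hs => ?_, univ_mem, ht⟩
    by_contra hn
    have hc : sᶜ ∈ F := Ultrafilter.compl_mem_iff_notMem.2 hn
    have hb : IsBounded sᶜ := isBounded_def.2 (by simpa using hs)
    obtain ⟨x, -, hx⟩ := hb.isCompact_closure.ultrafilter_le_nhds F
      (le_principal_iff.2 (mem_of_superset hc subset_closure))
    exact h2 ⟨x, tendsto_nhds_unique ((continuous_higsonEval.tendsto x).mono_left hx) ht⟩
  · intro hz
    obtain ⟨F, h1, -, h3⟩ := mem_trace_iff.1 hz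
    refine ⟨mem_closure_of_tendsto h3 (Eventually.of_forall fun x => mem_range_self x), ?_⟩
    rintro ⟨x, rfl⟩
    obtain ⟨f, hf1, hf0⟩ := exists_higsonFunction_bump x
    have h4 := tendsto_higsonEval_iff.1 h3 f
    have h5 : Tendsto (fun i => f.1 i) F (𝓝 0) :=
      tendsto_const_nhds.congr' ((hf0.filter_mono h1).mono fun y hy => hy.symm)
    have h6 := tendsto_nhds_unique h4 h5
    change f.1 x = 0 at h6
    linarith

/-- Two subsets are divergent if close pairs of their points stay in a bounded set. -/
def Divergent (A B : Set X) : Prop :=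
  ∀ r : ℝ, IsBounded {a | a ∈ A ∧ ∃ b ∈ B, dist a b ≤ r}

theorem Divergent.symm {A B : Set X} (h : Divergent A B) : Divergent B A := by
  intro r
  refine ((h r).cthickening (δ := r)).subset ?_
  rintro b ⟨hb, a, ha, hab⟩
  exact Metric.mem_cthickening_of_dist_le b a _ _ ⟨ha, b, hb, by rwa [dist_comm]⟩ hab

/-- Divergent sets are separated by a Higson function. -/
theorem Divergent.exists_higsonFunction [ProperSpace X] {A B : Set X} (h : Divergent A B)
    (hA : A.Nonempty) (hB : B.Nonempty) :
    ∃ f : higsonFunctions X, (∀ x ∈ A, f.1 x = 0) ∧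
      Tendsto f.1 (cobounded X ⊓ 𝓟 B) (𝓝 1) := by
  -- The separating function is `infDist x A / s x`; the summand `1` keeps the denominator positive.
  set s : X → ℝ := fun x => 1 + Metric.infDist x A + Metric.infDist x B with hs
  have hdA : ∀ x, 0 ≤ Metric.infDist x A := fun x => Metric.infDist_nonneg
  have hdB : ∀ x, 0 ≤ Metric.infDist x B := fun x => Metric.infDist_nonneg
  have hs0 : ∀ x, 0 < s x := fun x => by have := hdA x; have := hdB x; simp only [hs]; linarith
  have hsc : Continuous s :=
    (continuous_const.add (Metric.continuous_infDist_pt A)).add (Metric.continuous_infDist_pt B)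
  -- A point with `s x ≤ R` is within `R` of points `a ∈ A` and `b ∈ B`, which are then `2 *
  -- R`-close; divergence bounds such `a`.
  have hsinf : ∀ R : ℝ, ∀ᶠ x in cobounded X, R < s x := by
    intro R
    have hb := (h (2 * R)).cthickening (δ := R)
    filter_upwards [isBounded_def.1 hb] with x hx
    by_contra hR
    rw [not_lt] at hR
    apply hx
    have h1 : Metric.infDist x A < R := by have := hdB x; simp only [hs] at hR; linarith
    have h2 : Metric.infDist x B < R := by have := hdA x; simp only [hs] at hR; linarith
    obtain ⟨a, ha, hxa⟩ := (Metric.infDist_lt_iff hA).1 h1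
    obtain ⟨b, hb, hxb⟩ := (Metric.infDist_lt_iff hB).1 h2
    refine Metric.mem_cthickening_of_dist_le x a _ _ ⟨ha, b, hb, ?_⟩ hxa.le
    have := dist_triangle_left a b x
    linarith
  let g : X →ᵇ ℝ := BoundedContinuousFunction.ofNormedAddCommGroup
    (fun x => Metric.infDist x A / s x)
    ((Metric.continuous_infDist_pt A).div hsc fun x => (hs0 x).ne') 1 (fun x => by
      rw [Real.norm_eq_abs, abs_of_nonneg (div_nonneg (hdA x) (hs0 x).le), div_le_one (hs0 x)]
      have := hdB x
      simp only [hs]; linarith)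
  have hg : ∀ x, g x = Metric.infDist x A / s x := fun _ => rfl
  have hgd : ∀ r, ∀ x y, dist y x ≤ r → dist (g y) (g x) ≤ 3 * r / s x := by
    intro r x y hxy
    have a1 := Metric.infDist_le_infDist_add_dist (s := A) (x := x) (y := y)
    have a2 := Metric.infDist_le_infDist_add_dist (s := A) (x := y) (y := x)
    have b1 := Metric.infDist_le_infDist_add_dist (s := B) (x := x) (y := y)
    have b2 := Metric.infDist_le_infDist_add_dist (s := B) (x := y) (y := x)
    rw [dist_comm] at a1 b1
    have hr : 0 ≤ r := dist_nonneg.trans hxy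
    -- The numerator varies by at most `r`, `s` by at most `2 * r`, and the quotient at `y` is at
    -- most `1`: hence `3 * r / s x`.
    have e1 : g y - g x = ((Metric.infDist y A - Metric.infDist x A)
        + (Metric.infDist y A / s y) * (s x - s y)) / s x := by
      rw [hg, hg]
      have := (hs0 x).ne'
      have := (hs0 y).ne'
      field_simp
      ring
    have h01 : |Metric.infDist y A / s y| ≤ 1 := g.norm_coe_le_norm y |>.trans
      (BoundedContinuousFunction.norm_ofNormedAddCommGroup_le _ zero_le_one _)
    rw [Real.dist_eq, e1, abs_div, abs_of_pos (hs0 x)]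
    refine div_le_div_of_nonneg_right ?_ (hs0 x).le
    refine (abs_add_le _ _).trans ?_
    rw [abs_mul]
    have c1 : |Metric.infDist y A - Metric.infDist x A| ≤ r :=
      abs_le.2 ⟨by linarith, by linarith⟩
    have c2 : |s x - s y| ≤ 2 * r := abs_le.2 ⟨by simp only [hs]; linarith,
      by simp only [hs]; linarith⟩
    have c3 := mul_le_mul h01 c2 (abs_nonneg _) zero_le_one
    linarith
  refine ⟨⟨g, isHigsonFunction_of_eventually fun r hr ε hε => ?_⟩, fun x hx => ?_, ?_⟩
  · filter_upwards [hsinf (3 * r / ε)] with x hx y hy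
    refine (hgd r x y hy).trans ?_
    rw [div_le_iff₀ (hs0 x)]
    rw [div_lt_iff₀ hε] at hx
    linarith
  · change Metric.infDist x A / s x = 0
    rw [Metric.infDist_zero_of_mem hx, zero_div]
  · rw [Metric.tendsto_nhds]
    intro ε hε
    rw [eventually_inf_principal]
    filter_upwards [hsinf (1 / ε)] with x hx hxB
    have e1 : g x - 1 = - (1 / s x) := by
      rw [hg]
      have := (hs0 x).ne'
      field_simp
      simp only [hs, Metric.infDist_zero_of_mem hxB]
      ring
    change dist (g x) 1 < ε
    rw [Real.dist_eq, e1, abs_neg, abs_of_pos (by have := hs0 x; positivity),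
      div_lt_iff₀ (hs0 x)]
    rw [div_lt_iff₀ hε] at hx
    linarith

theorem Divergent.disjoint_trace [ProperSpace X] {A B : Set X} (h : Divergent A B) :
    Disjoint (trace A) (trace B) := by
  rw [disjoint_left]
  intro z hzA hzB
  obtain ⟨F, hF1, hF2, hF3⟩ := mem_trace_iff.1 hzA
  obtain ⟨G, hG1, hG2, hG3⟩ := mem_trace_iff.1 hzB
  obtain ⟨f, hfA, hfB⟩ := h.exists_higsonFunction (F.nonempty_of_mem hF2) (G.nonempty_of_mem hG2)
  have h1 := tendsto_higsonEval_iff.1 hF3 f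
  have h2 := tendsto_higsonEval_iff.1 hG3 f
  have h3 : Tendsto f.1 F (𝓝 0) := tendsto_const_nhds.congr'
    ((eventually_of_mem hF2 fun x hx => (hfA x hx).symm))
  have h4 : Tendsto f.1 G (𝓝 1) := hfB.mono_left (le_inf hG1 (le_principal_iff.2 hG2))
  have h5 := tendsto_nhds_unique h1 h3
  have h6 := tendsto_nhds_unique h2 h4
  linarith

/-- Points at bounded distance from points near a limit at infinity are also near it. -/
theorem eventually_forall_dist_le {F : Ultrafilter X} (hF : ↑F ≤ cobounded X)
    {z : HigsonCube X} (h : Tendsto (higsonEval X) F (𝓝 z)) {U : Set (HigsonCube X)}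
    (hU : U ∈ 𝓝 z) (r : ℝ) : ∀ᶠ x in (F : Filter X), ∀ y, dist y x ≤ r → higsonEval X y ∈ U := by
  by_contra hn
  rw [← Ultrafilter.frequently_iff_eventually, not_frequently] at hn
  -- Guarding the claim by a hypothesis lets `b` be chosen on all of `X`; only the bad `x` matter.
  have h2 : ∀ x : X, ∃ y, (¬ ∀ y, dist y x ≤ r → higsonEval X y ∈ U) →
      dist y x ≤ r ∧ higsonEval X y ∉ U := by
    intro x
    by_cases hx : ∀ y, dist y x ≤ r → higsonEval X y ∈ U
    · exact ⟨x, fun h => absurd hx h⟩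
    · push Not at hx
      obtain ⟨y, hy⟩ := hx
      exact ⟨y, fun _ => hy⟩
  choose b hb using h2
  have h3 : Tendsto (fun x => higsonEval X (b x)) F (𝓝 z) :=
    tendsto_higsonEval_of_dist_le (a := id) (r := r) hF (hn.mono fun x hx => (hb x hx).1) h
  obtain ⟨x, hx1, hx2⟩ := ((h3.eventually hU).and hn).exists
  exact (hb x hx2).2 hx1

/-- One step of length at most `c` inside a set. -/
def StepIn (c : ℝ) (S : Set X) (x y : X) : Prop := dist x y ≤ c ∧ x ∈ S ∧ y ∈ S

theorem StepIn.symm {c : ℝ} {S : Set X} {x y : X} (h : StepIn c S x y) : StepIn c S y x :=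
  ⟨by rw [dist_comm]; exact h.1, h.2.2, h.2.1⟩

theorem reflTransGen_stepIn_symm {c : ℝ} {S : Set X} {x y : X}
    (h : Relation.ReflTransGen (StepIn c S) x y) : Relation.ReflTransGen (StepIn c S) y x := by
  induction h with
  | refl => exact .refl
  | tail _ h2 ih => exact .head h2.symm ih

theorem reflTransGen_stepIn_mono {c : ℝ} {S T : Set X} (hST : S ⊆ T) {x y : X}
    (h : Relation.ReflTransGen (StepIn c S) x y) : Relation.ReflTransGen (StepIn c T) x y := by
  induction h with
  | refl => exact .refl
  | tail _ h2 ih => exact ih.tail ⟨h2.1, hST h2.2.1, hST h2.2.2⟩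

/-- With no step from `P` to `Q`, a chain starting in `P` would stay in `P`. -/
theorem exists_crossing_step {c : ℝ} {S P Q : Set X} (hS : S ⊆ P ∪ Q) {x y : X}
    (h : Relation.ReflTransGen (StepIn c S) x y) (hx : x ∈ P) (hy : y ∈ Q) (hPQ : Disjoint P Q) :
    ∃ a ∈ S ∩ P, ∃ b ∈ S ∩ Q, dist a b ≤ c := by
  by_contra hn
  push Not at hn
  have : y ∈ P := by
    clear hy
    induction h with
    | refl => exact hx
    | tail _ h2 ih =>
      rcases hS h2.2.2 with h | h
      · exact h
      · exact absurd h2.1 (not_le.2 (hn _ ⟨h2.2.1, ih⟩ _ ⟨h2.2.2, h⟩))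
  exact disjoint_left.1 hPQ this hy

/-- A set that is chain connected at infinity has a connected trace in the corona. -/
theorem isPreconnected_trace {A : Set X} {c : ℝ}
    (h : ∀ B : Set X, IsBounded B → ∃ B' : Set X, IsBounded B' ∧ ∀ x ∈ A \ B', ∀ y ∈ A \ B',
      Relation.ReflTransGen (StepIn c (A \ B)) x y) : IsPreconnected (trace A) := by
  rw [isPreconnected_closed_iff]
  intro C D hC hD hCD hAC hAD
  by_contra hne
  rw [not_nonempty_iff_eq_empty] at hne
  have hdis : Disjoint (trace A ∩ C) (trace A ∩ D) := by
    rw [disjoint_iff_inter_eq_empty, ← hne, inter_inter_inter_comm, inter_self]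
  obtain ⟨O, P, hO, hP, hCO, hDP, hOP⟩ := SeparatedNhds.of_isCompact_isCompact
    ((isCompact_trace A).inter_right hC) ((isCompact_trace A).inter_right hD) hdis
  have hcov : trace A ⊆ O ∪ P := fun z hz => (hCD hz).imp (fun h => hCO ⟨hz, h⟩)
    fun h => hDP ⟨hz, h⟩
  set PO : Set X := higsonEval X ⁻¹' O
  set PP : Set X := higsonEval X ⁻¹' P
  have hdisj : Disjoint PO PP := hOP.preimage _
  have hB0 : IsBounded (A \ (PO ∪ PP)) := by
    by_contra hb
    obtain ⟨z, hz⟩ := trace_nonempty hb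
    obtain ⟨F, hF1, hF2, hF3⟩ := mem_trace_iff.1 hz
    have hz2 : ∀ᶠ x in (F : Filter X), higsonEval X x ∈ O ∪ P :=
      hF3.eventually ((hO.union hP).mem_nhds (hcov (trace_mono sdiff_subset hz)))
    obtain ⟨x, hx1, hx2⟩ := (hz2.and hF2).exists
    exact hx2.2 hx1
  have hfar : ∀ Q : Set (HigsonCube X), IsOpen Q → (trace A ∩ Q).Nonempty →
      ∀ B : Set X, IsBounded B → ∃ x ∈ A \ B, higsonEval X x ∈ Q := by
    rintro Q hQ ⟨z, hz, hzQ⟩ B hB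
    obtain ⟨F, hF1, hF2, hF3⟩ := mem_trace_iff.1 hz
    obtain ⟨x, ⟨hx1, hx2⟩, hx3⟩ := (((hF3.eventually (hQ.mem_nhds hzQ)).and hF2).and
      (hF1 (isBounded_def.1 hB))).exists
    exact ⟨x, ⟨hx2, hx3⟩, hx1⟩
  -- The crossing places. If they were bounded, a chain avoiding them could not pass from `PO` to
  -- `PP`. Being unbounded, they have a limit in the corona, near which both a point and its
  -- `c`-neighbour evaluate into the same one of `O` and `P`.
  set S : Set X := {x | x ∈ A ∧ x ∈ PO ∧ ∃ y ∈ PP, dist y x ≤ c}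
  have hS : ¬ IsBounded S := by
    intro hSb
    obtain ⟨B', hB', hch⟩ := h _ (hB0.union hSb)
    obtain ⟨x, hx, hxO⟩ := hfar O hO
      (hAC.mono fun z hz => ⟨hz.1, hCO hz⟩) B' hB'
    obtain ⟨y, hy, hyP⟩ := hfar P hP
      (hAD.mono fun z hz => ⟨hz.1, hDP hz⟩) B' hB'
    obtain ⟨a, ha, b, hb, hab⟩ := exists_crossing_step (P := PO) (Q := PP)
      (fun w hw => by
        by_contra hwn
        exact hw.2 (Or.inl ⟨hw.1, hwn⟩)) (hch x hx y hy) hxO hyP hdisj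
    exact ha.1.2 (Or.inr ⟨ha.1.1, ha.2, b, hb.2, by rwa [dist_comm]⟩)
  obtain ⟨z, hz⟩ := trace_nonempty hS
  have hzA : z ∈ trace A := trace_mono (fun _ h => h.1) hz
  obtain ⟨F, hF1, hF2, hF3⟩ := mem_trace_iff.1 hz
  rcases hcov hzA with hzO | hzP
  · obtain ⟨x, hx1, hx2⟩ := ((eventually_forall_dist_le hF1 hF3 (hO.mem_nhds hzO) c).and
      hF2).exists
    obtain ⟨y, hy1, hy2⟩ := hx2.2.2
    exact disjoint_left.1 hOP (hx1 y hy2) hy1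
  · obtain ⟨x, hx1, hx2⟩ := ((hF3.eventually (hP.mem_nhds hzP)).and hF2).exists
    exact disjoint_left.1 hOP hx2.2.1 hx1

end Corona

/-! ### The homeomorphism of coronas induced by a coarse embedding. -/

section Pullback

variable {X : Type u} {Y : Type v} [MetricSpace X] [MetricSpace Y]

/-- Outside a bounded set `f` varies by less than `t - s` over distance `r`. -/
theorem divergent_sublevel_superlevel [ProperSpace X] (f : higsonFunctions X) {s t : ℝ}
    (h : s < t) : Divergent {x | f.1 x ≤ s} {x | t ≤ f.1 x} := by
  intro r
  rw [isBounded_def]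
  filter_upwards [eventually_dist_lt f r (sub_pos.2 h)] with x hx
  rintro ⟨h1, y, h2, h3⟩
  have h4 := hx y (by rwa [dist_comm])
  rw [Real.dist_eq] at h4
  have := le_abs_self (f.1 y - f.1 x)
  have h5 : f.1 x ≤ s := h1
  have h6 : t ≤ f.1 y := h2
  linarith

/-- A continuous coarse embedding with coarsely dense image. -/
structure IsCoarseDenseEmbedding (φ : Y → X) : Prop where
  continuous : Continuous φ
  expansive : ∀ r : ℝ, ∃ s : ℝ, ∀ y y', dist y y' ≤ r → dist (φ y) (φ y') ≤ s
  proper : ∀ r : ℝ, ∃ s : ℝ, ∀ y y', dist (φ y) (φ y') ≤ r → dist y y' ≤ s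
  dense : ∃ C : ℝ, ∀ x, ∃ y, dist (φ y) x ≤ C

variable {φ : Y → X}

theorem IsCoarseDenseEmbedding.tendsto_cobounded (h : IsCoarseDenseEmbedding φ) :
    Tendsto φ (cobounded Y) (cobounded X) := by
  intro U hU
  rw [mem_map, ← isCobounded_def, ← isBounded_compl_iff, ← preimage_compl, Metric.isBounded_iff]
  obtain ⟨C, hC⟩ := Metric.isBounded_iff.1 (isBounded_compl_iff.2 (isCobounded_def.2 hU))
  obtain ⟨s, hs⟩ := h.proper C
  exact ⟨s, fun y hy y' hy' => hs _ _ (hC hy hy')⟩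

theorem IsCoarseDenseEmbedding.divergent_image (h : IsCoarseDenseEmbedding φ) {A B : Set Y}
    (hAB : Divergent A B) : Divergent (φ '' A) (φ '' B) := by
  intro r
  obtain ⟨s, hs⟩ := h.proper r
  have hb := hAB s
  obtain ⟨C, hC⟩ := Metric.isBounded_iff.1 hb
  obtain ⟨s', hs'⟩ := h.expansive C
  refine Metric.isBounded_iff.2 ⟨s', ?_⟩
  rintro _ ⟨⟨a, ha, rfl⟩, _, ⟨b, hb, rfl⟩, hab⟩ _ ⟨⟨a', ha', rfl⟩, _, ⟨b', hb', rfl⟩, hab'⟩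
  exact hs' _ _ (hC ⟨ha, b, hb, hs _ _ hab⟩ ⟨ha', b', hb', hs _ _ hab'⟩)

/-- Pullback of Higson functions. -/
noncomputable def IsCoarseDenseEmbedding.comp [ProperSpace Y] (h : IsCoarseDenseEmbedding φ)
    (f : higsonFunctions X) : higsonFunctions Y :=
  ⟨f.1.compContinuous ⟨φ, h.continuous⟩, isHigsonFunction_of_eventually fun r _ ε hε => by
    obtain ⟨s, hs⟩ := h.expansive r
    filter_upwards [h.tendsto_cobounded.eventually (eventually_dist_lt f s hε)] with y hy z hz
    exact (hy _ (hs _ _ hz)).le⟩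

/-- The map of Higson cubes induced by a coarse embedding. -/
noncomputable def IsCoarseDenseEmbedding.cubeMap [ProperSpace Y] [Nonempty Y]
    (h : IsCoarseDenseEmbedding φ) (z : HigsonCube Y) : HigsonCube X := fun f =>
  ⟨z (h.comp f),
    (le_ciInf fun y => ciInf_le f.1.isBounded_range.bddBelow (φ y)).trans (z (h.comp f)).2.1,
    (z (h.comp f)).2.2.trans
      (ciSup_le fun y => le_ciSup f.1.isBounded_range.bddAbove (φ y))⟩

variable [ProperSpace Y] [Nonempty Y]

theorem IsCoarseDenseEmbedding.continuous_cubeMap (h : IsCoarseDenseEmbedding φ) :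
    Continuous h.cubeMap :=
  continuous_pi fun f =>
    (continuous_subtype_val.comp (continuous_apply (h.comp f))).subtype_mk _

theorem IsCoarseDenseEmbedding.tendsto_of_tendsto (h : IsCoarseDenseEmbedding φ) {F : Filter Y}
    {z : HigsonCube Y} (hz : Tendsto (higsonEval Y) F (𝓝 z)) :
    Tendsto (fun y => higsonEval X (φ y)) F (𝓝 (h.cubeMap z)) :=
  (h.continuous_cubeMap.tendsto z).comp hz

variable [ProperSpace X]

theorem IsCoarseDenseEmbedding.mapsTo (h : IsCoarseDenseEmbedding φ) :
    MapsTo h.cubeMap (higsonCorona Y) (higsonCorona X) := by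
  intro z hz
  rw [higsonCorona_eq_trace] at hz ⊢
  obtain ⟨F, hF1, -, hF3⟩ := mem_trace_iff.1 hz
  exact mem_trace_of_tendsto (h.tendsto_cobounded.mono_left hF1)
    (Eventually.of_forall fun _ => mem_univ _) (h.tendsto_of_tendsto hF3)

/-- Two corona points differ in some coordinate `g`. Sublevel and superlevel sets of `g` diverge,
hence so do their images under `φ`, whose disjoint traces contain the two image points. No Higson
function has to be extended from `Y` to `X`. -/
theorem IsCoarseDenseEmbedding.injOn (h : IsCoarseDenseEmbedding φ) :
    InjOn h.cubeMap (higsonCorona Y) := by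
  have key : ∀ z ∈ higsonCorona Y, ∀ w ∈ higsonCorona Y, h.cubeMap z = h.cubeMap w →
      ∀ g, ¬ (z g : ℝ) < w g := by
    intro z hz w hw hzw g hlt
    rw [higsonCorona_eq_trace] at hz hw
    obtain ⟨F, hF1, -, hF3⟩ := mem_trace_iff.1 hz
    obtain ⟨G, hG1, -, hG3⟩ := mem_trace_iff.1 hw
    obtain ⟨s, hs1, hs2⟩ := exists_between hlt
    obtain ⟨t, ht1, ht2⟩ := exists_between hs2
    have hd := (h.divergent_image (divergent_sublevel_superlevel g ht1)).disjoint_trace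
    refine disjoint_left.1 hd (?_ : h.cubeMap z ∈ _) ?_
    · refine mem_trace_of_tendsto (h.tendsto_cobounded.mono_left hF1) ?_
        (h.tendsto_of_tendsto hF3)
      filter_upwards [(tendsto_higsonEval_iff.1 hF3 g).eventually_lt_const hs1] with y hy
      exact mem_image_of_mem _ hy.le
    · rw [hzw]
      refine mem_trace_of_tendsto (h.tendsto_cobounded.mono_left hG1) ?_
        (h.tendsto_of_tendsto hG3)
      filter_upwards [(tendsto_higsonEval_iff.1 hG3 g).eventually_const_lt ht2] with y hy
      exact mem_image_of_mem _ hy.le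
  intro z hz w hw hzw
  funext g
  exact Subtype.ext (le_antisymm (not_lt.1 (key w hw z hz hzw.symm g))
    (not_lt.1 (key z hz w hw hzw g)))

/-- A coarse inverse `ψ` satisfies `dist (φ (ψ x)) x ≤ C`, so `φ ∘ ψ` has the same limits at
infinity as the identity; a limit of `ψ` along `F` is a preimage. -/
theorem IsCoarseDenseEmbedding.surjOn (h : IsCoarseDenseEmbedding φ) :
    SurjOn h.cubeMap (higsonCorona Y) (higsonCorona X) := by
  intro z hz
  rw [higsonCorona_eq_trace] at hz ⊢
  obtain ⟨F, hF1, -, hF3⟩ := mem_trace_iff.1 hz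
  obtain ⟨C, hC⟩ := h.dense
  choose ψ hψ using hC
  have h1 : Tendsto (fun x => higsonEval X (φ (ψ x))) F (𝓝 z) :=
    tendsto_higsonEval_of_dist_le (a := id) hF1 (Eventually.of_forall hψ) hF3
  obtain ⟨w, hw⟩ := exists_tendsto_higsonEval ψ F
  have h2 : Tendsto ψ F (cobounded Y) := by
    intro U hU
    refine hF1 ?_
    rw [← isCobounded_def, ← isBounded_compl_iff, Metric.isBounded_iff]
    obtain ⟨D, hD⟩ := Metric.isBounded_iff.1 (isBounded_compl_iff.2 (isCobounded_def.2 hU))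
    obtain ⟨s, hs⟩ := h.expansive D
    refine ⟨C + s + C, fun x hx x' hx' => ?_⟩
    have h3 := hs _ _ (hD hx hx')
    have h4 := dist_triangle4 x (φ (ψ x)) (φ (ψ x')) x'
    have h5 := hψ x
    have h6 := hψ x'
    rw [dist_comm] at h5
    linarith
  refine ⟨w, mem_trace_of_tendsto h2 (Eventually.of_forall fun _ => mem_univ _) hw, ?_⟩
  exact tendsto_nhds_unique ((h.continuous_cubeMap.tendsto w).comp hw) h1

/-- A coarsely dense continuous coarse embedding induces a homeomorphism of Higson coronas. -/
theorem IsCoarseDenseEmbedding.nonempty_homeomorph (h : IsCoarseDenseEmbedding φ) :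
    Nonempty (higsonCorona Y ≃ₜ higsonCorona X) := by
  have : CompactSpace (higsonCorona Y) := by
    rw [← isCompact_iff_compactSpace, higsonCorona_eq_trace]
    exact isCompact_trace _
  let e : higsonCorona Y ≃ higsonCorona X :=
    BijOn.equiv _ ⟨h.mapsTo, h.injOn, h.surjOn⟩
  have he : Continuous e :=
    (h.continuous_cubeMap.comp continuous_subtype_val).subtype_mk _
  exact ⟨he.homeoOfEquivCompactToT2⟩

end Pullback

/-! ### Continua and decomposability. -/

section Topology

theorem isContinuum_of_homeomorph {K : Type u} {L : Type v} [TopologicalSpace K]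
    [TopologicalSpace L] (e : K ≃ₜ L) (h : IsContinuum K) : IsContinuum L := by
  obtain ⟨h1, h2, h3⟩ := h
  refine ⟨e.compactSpace, ?_, e.t2Space⟩
  exact e.surjective.connectedSpace e.continuous

theorem isDecomposable_of_homeomorph {K : Type u} {L : Type v} [TopologicalSpace K]
    [TopologicalSpace L] (e : K ≃ₜ L) (h : IsDecomposable K) : IsDecomposable L := by
  obtain ⟨A, B, hA, hB, hA', hB', hAB⟩ := h
  refine ⟨e '' A, e '' B, isContinuum_of_homeomorph (e.image A) hA,
    isContinuum_of_homeomorph (e.image B) hB, ?_, ?_, ?_⟩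
  · rwa [Ne, ← image_univ_of_surjective e.surjective, e.injective.image_injective.eq_iff]
  · rwa [Ne, ← image_univ_of_surjective e.surjective, e.injective.image_injective.eq_iff]
  · rw [← image_union, hAB, image_univ, e.range_coe]

theorem isIndecomposableContinuum_of_homeomorph {K : Type u} {L : Type v} [TopologicalSpace K]
    [TopologicalSpace L] (e : K ≃ₜ L) (h : IsIndecomposableContinuum K) :
    IsIndecomposableContinuum L :=
  ⟨isContinuum_of_homeomorph e h.1, fun hd => h.2 (isDecomposable_of_homeomorph e.symm hd)⟩

theorem isContinuum_coe_iff {K : Type u} [TopologicalSpace K] [T2Space K] {A : Set K} :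
    IsContinuum A ↔ IsCompact A ∧ IsConnected A := by
  rw [IsContinuum, isCompact_iff_compactSpace, isConnected_iff_connectedSpace]
  exact ⟨fun h => ⟨h.1, h.2.1⟩, fun h => ⟨h.1, h.2, inferInstance⟩⟩

variable {K : Type u} [TopologicalSpace K]

/-- If a connected space is the union of a closed connected subset `A` and two disjoint closed
subsets, then the union of `A` with one of them is connected. -/
theorem isPreconnected_union_of_disjoint [PreconnectedSpace K] {A U V : Set K}
    (hA : IsConnected A) (hAc : IsClosed A) (hU : IsClosed U) (hV : IsClosed V)
    (hUV : Disjoint U V) (hcov : A ∪ U ∪ V = univ) : IsPreconnected (A ∪ U) := by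
  -- If `P` contains `A`, the other piece `Q` lies in `U` and so misses `V`; then `P ∪ V` and `Q`
  -- would separate the whole space.
  have key : ∀ P Q : Set K, IsClosed P → IsClosed Q → A ∪ U = P ∪ Q → Disjoint P Q → A ⊆ P →
      ¬ Q.Nonempty := by
    intro P Q hP hQ hPQ hd hAP hne
    have hQU : Q ⊆ U := fun x hx => by
      have : x ∈ A ∪ U := hPQ ▸ Or.inr hx
      exact this.resolve_left fun hxA => disjoint_left.1 hd (hAP hxA) hx
    have hpre := isPreconnected_closed_iff.1 (isPreconnected_univ (α := K)) (P ∪ V) Q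
      (hP.union hV) hQ (fun x _ => by
        have : x ∈ A ∪ U ∪ V := hcov ▸ mem_univ x
        rw [hPQ] at this
        rcases this with (h | h) | h
        · exact Or.inl (Or.inl h)
        · exact Or.inr h
        · exact Or.inl (Or.inr h))
    obtain ⟨x, -, hx1, hx2⟩ := hpre
      (by simpa only [univ_inter] using (hA.nonempty.mono hAP).mono subset_union_left)
      (by simpa only [univ_inter] using hne)
    rcases hx1 with hx1 | hx1
    · exact disjoint_left.1 hd hx1 hx2
    · exact disjoint_left.1 hUV (hQU hx2) hx1
  rw [isPreconnected_closed_iff]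
  intro C D hC hD hCD hC' hD'
  by_contra hne
  rw [not_nonempty_iff_eq_empty] at hne
  have hdis : Disjoint ((A ∪ U) ∩ C) ((A ∪ U) ∩ D) := by
    rw [disjoint_iff_inter_eq_empty, ← hne, inter_inter_inter_comm, inter_self]
  have hAU := hAc.union hU
  have hun : A ∪ U = ((A ∪ U) ∩ C) ∪ ((A ∪ U) ∩ D) := by
    rw [← inter_union_distrib_left, inter_eq_left.2 hCD]
  rcases isPreconnected_iff_subset_of_disjoint_closed.1 hA.isPreconnected _ _ (hAU.inter hC)
    (hAU.inter hD) (hun ▸ subset_union_left)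
    (by rw [hdis.inter_eq, inter_empty]) with h | h
  · exact key _ _ (hAU.inter hC) (hAU.inter hD) hun hdis h hD'
  · exact key _ _ (hAU.inter hD) (hAU.inter hC) (by rwa [union_comm ((A ∪ U) ∩ D)]) hdis.symm h hC'

/-- A continuum with a proper subcontinuum that has an interior point is decomposable. -/
theorem isDecomposable_of_subcontinuum (hK : IsContinuum K) {A D : Set K} (hAc : IsClosed A)
    (hA : IsConnected A) (hA' : A ≠ univ) (hD : IsClosed D) (hD' : D ≠ univ)
    (hAD : A ∪ D = univ) : IsDecomposable K := by
  obtain ⟨h1, h2, h3⟩ := hK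
  set W := closure Aᶜ with hW
  have hWD : W ⊆ D := closure_minimal (fun x hx =>
    (hAD ▸ mem_univ x : x ∈ A ∪ D).resolve_left hx) hD
  have hWc : IsClosed W := isClosed_closure
  have hAW : A ∪ W = univ := eq_univ_of_forall fun x => by
    by_cases h : x ∈ A
    · exact Or.inl h
    · exact Or.inr (subset_closure h)
  have hWne : W.Nonempty := (nonempty_compl.2 hA').mono subset_closure
  -- If `W` is connected, `A` and `W` decompose `K`. Otherwise `W` splits into two closed parts, and
  -- `A` together with either part is connected.
  by_cases hWp : IsPreconnected W
  · exact ⟨A, W, isContinuum_coe_iff.2 ⟨hAc.isCompact, hA⟩,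
      isContinuum_coe_iff.2 ⟨hWc.isCompact, hWne, hWp⟩, hA',
      fun h => hD' (univ_subset_iff.1 (h ▸ hWD)), hAW⟩
  · rw [isPreconnected_closed_iff] at hWp
    push Not at hWp
    obtain ⟨C, E, hC, hE, hCE, hC', hE', hne⟩ := hWp
    have hdis : Disjoint (W ∩ C) (W ∩ E) := by
      rw [disjoint_iff_inter_eq_empty, ← hne, inter_inter_inter_comm, inter_self]
    have hun : W = (W ∩ C) ∪ (W ∩ E) := by
      rw [← inter_union_distrib_left, inter_eq_left.2 hCE]
    have hproper : ∀ C E : Set K, IsClosed C → W = (W ∩ C) ∪ (W ∩ E) →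
        Disjoint (W ∩ C) (W ∩ E) → (W ∩ E).Nonempty → A ∪ W ∩ C ≠ univ := by
      intro C E hC hun hdis hE hu
      -- Since `W` is the closure of `Aᶜ`, points of `Aᶜ` occur near `x`, off the closed set `C`.
      obtain ⟨x, hxW, hxE⟩ := hE
      have hxC : x ∉ C := fun h => disjoint_left.1 hdis ⟨hxW, h⟩ ⟨hxW, hxE⟩
      obtain ⟨y, hyC, hyA⟩ := mem_closure_iff.1 hxW Cᶜ hC.isOpen_compl hxC
      rcases (hu ▸ mem_univ y : y ∈ A ∪ W ∩ C) with h | h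
      · exact hyA h
      · exact hyC h.2
    have hcov : A ∪ W ∩ C ∪ W ∩ E = univ := by rw [union_assoc, ← hun, hAW]
    have hcov' : A ∪ W ∩ E ∪ W ∩ C = univ := by rw [union_assoc, union_comm (W ∩ E), ← hun, hAW]
    refine ⟨A ∪ W ∩ C, A ∪ W ∩ E, ?_, ?_, hproper C E hC hun hdis hE',
      hproper E C hE (by rwa [union_comm]) hdis.symm hC', ?_⟩
    · exact isContinuum_coe_iff.2 ⟨(hAc.union (hWc.inter hC)).isCompact,
        hA.nonempty.mono subset_union_left, isPreconnected_union_of_disjoint hA hAc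
          (hWc.inter hC) (hWc.inter hE) hdis hcov⟩
    · exact isContinuum_coe_iff.2 ⟨(hAc.union (hWc.inter hE)).isCompact,
        hA.nonempty.mono subset_union_left, isPreconnected_union_of_disjoint hA hAc
          (hWc.inter hE) (hWc.inter hC) hdis.symm hcov'⟩
    · rw [← union_union_distrib_left, ← hun, hAW]

end Topology

/-! ### Subcontinua of the corona -/

section Corona

variable {X : Type u} [MetricSpace X] [ProperSpace X]

theorem isContinuum_higsonCorona_iff :
    IsContinuum (higsonCorona X) ↔ IsConnected (higsonCorona X) := by
  rw [isContinuum_coe_iff, and_iff_right]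
  rw [higsonCorona_eq_trace]
  exact isCompact_trace _

/-- The traces of `A` and `Aᶜ` cover the corona, so `trace A` has interior as soon as `trace Aᶜ` is
not everything. -/
theorem isDecomposable_higsonCorona (hX : IsContinuum (higsonCorona X)) {A : Set X}
    (hA : IsConnected (trace A)) (hA' : ¬ trace univ ⊆ trace A)
    (hA'' : ¬ trace univ ⊆ trace Aᶜ) : IsDecomposable (higsonCorona X) := by
  have hsub : ∀ B : Set X, trace B ⊆ higsonCorona X := fun B => by
    rw [higsonCorona_eq_trace]
    exact trace_mono (subset_univ _)
  have hne : ∀ B : Set X, ¬ trace univ ⊆ trace B →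
      (Subtype.val ⁻¹' trace B : Set (higsonCorona X)) ≠ univ := by
    intro B hB h
    apply hB
    rw [← higsonCorona_eq_trace]
    intro z hz
    exact (h ▸ mem_univ _ : (⟨z, hz⟩ : higsonCorona X) ∈ Subtype.val ⁻¹' trace B)
  refine isDecomposable_of_subcontinuum hX ((isClosed_trace A).preimage continuous_subtype_val)
    ?_ (hne A hA') ((isClosed_trace Aᶜ).preimage continuous_subtype_val) (hne _ hA'') ?_
  · obtain ⟨z, hz⟩ := hA.nonempty
    refine ⟨⟨⟨z, hsub A hz⟩, hz⟩, ?_⟩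
    rw [← Topology.IsInducing.subtypeVal.isPreconnected_image, Subtype.image_preimage_coe,
      inter_eq_right.2 (hsub A)]
    exact hA.isPreconnected
  · rw [← preimage_union, ← trace_union, union_compl_self, ← higsonCorona_eq_trace]
    exact Subtype.coe_preimage_self _

end Corona

/-! ### The corona of `ℕ` is an indecomposable continuum. -/

section HalfLine

theorem nat_dist_eq (m n : ℕ) : dist m n = |(m : ℝ) - n| := rfl

theorem isBounded_Iio_nat (n : ℕ) : IsBounded (Iio n) := (finite_Iio n).isBounded

theorem exists_lt_of_isBounded_nat {S : Set ℕ} (hS : IsBounded S) : ∃ M, ∀ n ∈ S, n < M := by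
  obtain ⟨R, hR⟩ := (Metric.isBounded_iff_subset_closedBall 0).1 hS
  obtain ⟨M, hM⟩ := exists_nat_gt R
  refine ⟨M, fun n hn => ?_⟩
  have h1 := hR hn
  rw [Metric.mem_closedBall, nat_dist_eq] at h1
  have h3 := le_abs_self ((n : ℝ) - (0 : ℕ))
  push_cast at h1 h3
  have h2 : (n : ℝ) < M := by linarith
  exact_mod_cast h2

theorem exists_lt_of_mem_ultrafilter {F : Ultrafilter ℕ} (hF : ↑F ≤ cobounded ℕ) {S : Set ℕ}
    (hS : S ∈ F) (n : ℕ) : ∃ m ∈ S, n < m := by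
  obtain ⟨m, hm1, hm2⟩ := F.nonempty_of_mem
    (inter_mem hS (hF (isBounded_def.1 (isBounded_Iio_nat (n + 1)))))
  exact ⟨m, hm1, by simpa using hm2⟩

theorem isConnected_higsonCorona_nat : IsConnected (higsonCorona ℕ) := by
  rw [higsonCorona_eq_trace]
  refine ⟨trace_nonempty ?_, isPreconnected_trace (c := 1) fun B hB => ?_⟩
  · intro h
    obtain ⟨M, hM⟩ := exists_lt_of_isBounded_nat h
    exact (hM M (mem_univ M)).false
  · obtain ⟨M, hM⟩ := exists_lt_of_isBounded_nat hB
    have hout : ∀ n, M ≤ n → n ∈ univ \ B := fun n hn =>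
      ⟨mem_univ _, fun h => (hM n h).not_ge hn⟩
    have hch : ∀ n, M ≤ n → Relation.ReflTransGen (StepIn 1 (univ \ B)) M n := by
      intro n hn
      induction n, hn using Nat.le_induction with
      | base => exact .refl
      | succ n hn ih =>
        exact ih.tail ⟨by rw [nat_dist_eq]; push_cast; norm_num, hout n hn,
          hout _ (hn.trans n.le_succ)⟩
    refine ⟨Iio M, isBounded_Iio_nat M, fun x hx y hy => ?_⟩
    exact (reflTransGen_stepIn_symm (hch x (by simpa using hx))).trans (hch y (by simpa using hy))

/-- Unions of alternating blocks whose long initial and final segments are removed diverge. -/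
theorem divergent_blocks {b : ℕ → ℕ} (hb : StrictMono b) {Q : Set ℕ}
    (hQ : ∀ k n, dist n (b k) ≤ (k : ℝ) → n ∉ Q) {I J : Set ℕ} (hIJ : Disjoint I J) :
    Divergent {n | n ∈ Q ∧ ∃ k ∈ I, b k ≤ n ∧ n < b (k + 1)}
      {n | n ∈ Q ∧ ∃ k ∈ J, b k ≤ n ∧ n < b (k + 1)} := by
  -- Going from block `i` to a later block crosses `b (i + 1)`, around which `Q` has a gap of radius
  -- `i + 1`. A distance of at most `r` thus forces `i + 1 < r`.
  have key : ∀ i j n m : ℕ, i < j → n ∈ Q → n < b (i + 1) → b j ≤ m → ∀ r : ℕ,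
      dist n m ≤ (r : ℝ) → n < b r := by
    intro i j n m hij hn hni hjm r hr
    have h1 := hb.monotone (show i + 1 ≤ j from hij)
    have h2 : ¬ dist n (b (i + 1)) ≤ ((i + 1 : ℕ) : ℝ) := fun h => hQ _ _ h hn
    have h3 : dist n (b (i + 1)) ≤ dist n m := by
      have h4 : (n : ℝ) < b (i + 1) := by exact_mod_cast hni
      have h5 : (b (i + 1) : ℝ) ≤ m := by exact_mod_cast h1.trans hjm
      rw [nat_dist_eq, nat_dist_eq, abs_sub_comm, abs_sub_comm (n : ℝ), abs_of_pos, abs_of_pos] <;>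
        linarith
    have h6 : ((i + 1 : ℕ) : ℝ) < r := (not_le.1 h2).trans_le (h3.trans hr)
    exact hni.trans_le (hb.monotone (by exact_mod_cast h6.le))
  intro r
  obtain ⟨R, hR⟩ := exists_nat_ge r
  refine (isBounded_Iio_nat (b R + R + 1)).subset ?_
  rintro n ⟨⟨hnQ, i, hi, hn1, hn2⟩, m, ⟨hmQ, j, hj, hm1, hm2⟩, hnm⟩
  have hij : i ≠ j := fun h => disjoint_left.1 hIJ hi (h ▸ hj)
  have hd : dist n m ≤ (R : ℝ) := hnm.trans hR
  rw [mem_Iio]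
  rcases lt_or_gt_of_ne hij with h | h
  · have := key i j n m h hnQ hn2 hm1 R hd
    omega
  · have h1 := key j i m n h hmQ hm2 hn1 R (by rwa [dist_comm])
    have h2 : (n : ℝ) ≤ m + R := by
      rw [nat_dist_eq] at hd
      linarith [le_abs_self ((n : ℝ) - m)]
    have h3 : n ≤ m + R := by exact_mod_cast h2
    omega

/-- Proper subcontinua of `νℕ` have empty interior. -/
theorem not_isPreconnected_of_subset_higsonCorona_nat {A B : Set (HigsonCube ℕ)}
    (hA : IsCompact A) (hB : IsCompact B) (hAB : A ∪ B = higsonCorona ℕ) {p q : HigsonCube ℕ}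
    (hp : p ∈ A) (hpB : p ∉ B) (hq : q ∈ B) (hqA : q ∉ A) : ¬ IsPreconnected A := by
  intro hpre
  have hqν : q ∈ trace univ := by rw [← higsonCorona_eq_trace, ← hAB]; exact Or.inr hq
  have hpν : p ∈ trace univ := by rw [← higsonCorona_eq_trace, ← hAB]; exact Or.inl hp
  obtain ⟨OA, Oq, hOA, hOq, hAOA, hqOq, hdA⟩ := SeparatedNhds.of_isCompact_isCompact hA
    (isCompact_singleton (x := q)) (by simpa using hqA)
  obtain ⟨OB, Op, hOB, hOp, hBOB, hpOp, hdB⟩ := SeparatedNhds.of_isCompact_isCompact hB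
    (isCompact_singleton (x := p)) (by simpa using hpB)
  rw [singleton_subset_iff] at hqOq hpOp
  obtain ⟨F, hF1, -, hF3⟩ := mem_trace_iff.1 hqν
  obtain ⟨G, hG1, -, hG3⟩ := mem_trace_iff.1 hpν
  -- Near `q` there are centres, beyond any `n`, of whole intervals of radius `k` that evaluate into
  -- `Oq`.
  have hβ : ∀ k n : ℕ, ∃ m, n < m ∧ ∀ l, dist l m ≤ (k : ℝ) → higsonEval ℕ l ∈ Oq := by
    intro k n
    obtain ⟨m, hm1, hm2⟩ := exists_lt_of_mem_ultrafilter hF1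
      (eventually_forall_dist_le hF1 hF3 (hOq.mem_nhds hqOq) k) n
    exact ⟨m, hm2, hm1⟩
  have hα : ∀ n : ℕ, ∃ m, n < m ∧ higsonEval ℕ m ∈ Op ∩ OA := by
    intro n
    obtain ⟨m, hm1, hm2⟩ := exists_lt_of_mem_ultrafilter hG1
      (hG3.eventually ((hOp.inter hOA).mem_nhds ⟨hpOp, hAOA hp⟩)) n
    exact ⟨m, hm2, hm1⟩
  choose β hβ1 hβ2 using hβ
  choose α hα1 hα2 using hα
  -- Alternation: after the gap centre `b k` comes a point `α (b k)` near `p`, then the centre `b (k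
  -- + 1)` of a gap of radius `k + 1`.
  let b : ℕ → ℕ := fun k => Nat.rec (β 0 0) (fun k m => β (k + 1) (α m)) k
  have hbs : ∀ k, b (k + 1) = β (k + 1) (α (b k)) := fun _ => rfl
  have hbα : ∀ k, b k < α (b k) ∧ α (b k) < b (k + 1) := fun k =>
    ⟨hα1 _, by rw [hbs]; exact hβ1 _ _⟩
  have hb : StrictMono b := strictMono_nat_of_lt_succ fun k => (hbα k).1.trans (hbα k).2
  have hbO : ∀ k n, dist n (b k) ≤ (k : ℝ) → higsonEval ℕ n ∈ Oq := by
    intro k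
    cases k with
    | zero => exact hβ2 0 0
    | succ k => rw [hbs]; exact hβ2 _ _
  set Q : Set ℕ := {n | higsonEval ℕ n ∉ Oq}
  set blocks : Set ℕ → Set ℕ := fun I => {n | n ∈ Q ∧ ∃ k ∈ I, b k ≤ n ∧ n < b (k + 1)}
  have hdiv : Disjoint (trace (blocks {k | Even k})) (trace (blocks {k | Even k}ᶜ)) :=
    (divergent_blocks (Q := Q) hb (fun k n h hn => hn (hbO k n h)) disjoint_compl_right).disjoint_trace
  have hcover : A ⊆ trace (blocks {k | Even k}) ∪ trace (blocks {k | Even k}ᶜ) := by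
    intro z hz
    have hzν : z ∈ trace univ := by rw [← higsonCorona_eq_trace, ← hAB]; exact Or.inl hz
    obtain ⟨H, hH1, -, hH3⟩ := mem_trace_iff.1 hzν
    rw [← trace_union]
    refine mem_trace_iff.2 ⟨H, hH1, ?_, hH3⟩
    filter_upwards [hH3.eventually (hOA.mem_nhds (hAOA hz)),
      hH1 (isBounded_def.1 (isBounded_Iio_nat (b 0)))] with n hn1 hn2
    have hnQ : n ∈ Q := fun h => disjoint_left.1 hdA hn1 h
    obtain ⟨k, hk1, hk2⟩ : ∃ k, b k ≤ n ∧ n < b (k + 1) := by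
      have hex : ∃ k, n < b (k + 1) := ⟨n, hb.le_apply (x := n + 1)⟩
      classical
      refine ⟨Nat.find hex, ?_, Nat.find_spec hex⟩
      rcases h : Nat.find hex with _ | k
      · simpa using hn2
      · exact not_lt.1 (Nat.find_min hex (m := k) (by omega))
    by_cases hk : Even k
    · exact Or.inl ⟨hnQ, k, hk, hk1, hk2⟩
    · exact Or.inr ⟨hnQ, k, hk, hk1, hk2⟩
  -- Limits of the points `α (b k)` are not in `B`, because these points evaluate into `Op`, which
  -- misses `OB`; hence they are in `A`.
  have hmeet : ∀ I : Set ℕ, (∀ n, ∃ k ∈ I, n ≤ k) → (A ∩ trace (blocks I)).Nonempty := by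
    intro I hI
    have hne : ¬ IsBounded ((fun k => α (b k)) '' I) := by
      intro h
      obtain ⟨M, hM⟩ := exists_lt_of_isBounded_nat h
      obtain ⟨k, hk, hMk⟩ := hI M
      have h1 := hM _ (mem_image_of_mem _ hk)
      have h2 := hb.le_apply (x := k)
      have h3 := (hbα k).1
      omega
    obtain ⟨z, hz⟩ := trace_nonempty hne
    obtain ⟨H, hH1, hH2, hH3⟩ := mem_trace_iff.1 hz
    refine ⟨z, ?_, trace_mono ?_ hz⟩
    · have hzν : z ∈ A ∪ B := by
        rw [hAB, higsonCorona_eq_trace]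
        exact trace_mono (subset_univ _) hz
      refine hzν.resolve_right fun hzB => ?_
      obtain ⟨n, hn1, k, hk, rfl⟩ := ((hH3.eventually (hOB.mem_nhds (hBOB hzB))).and hH2).exists
      exact disjoint_left.1 hdB hn1 (hα2 _).1
    · rintro _ ⟨k, hk, rfl⟩
      exact ⟨fun h => disjoint_left.1 hdA (hα2 _).2 h, k, hk, (hbα k).1.le, (hbα k).2⟩
  obtain ⟨z, -, hz1, hz2⟩ := isPreconnected_closed_iff.1 hpre _ _ (isClosed_trace _)
    (isClosed_trace _) hcover
    (hmeet _ fun n => ⟨2 * n, even_two_mul n, by omega⟩)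
    (hmeet _ fun n => ⟨2 * n + 1, by simp, by omega⟩)
  exact disjoint_left.1 hdiv hz1 hz2

theorem isIndecomposableContinuum_higsonCorona_nat :
    IsIndecomposableContinuum (higsonCorona ℕ) := by
  refine ⟨isContinuum_higsonCorona_iff.2 isConnected_higsonCorona_nat, ?_⟩
  rintro ⟨A, B, hA, hB, hA', hB', hAB⟩
  rw [isContinuum_coe_iff] at hA hB
  obtain ⟨q, hq⟩ := (ne_univ_iff_exists_notMem A).1 hA'
  obtain ⟨p, hp⟩ := (ne_univ_iff_exists_notMem B).1 hB'
  have hpA : p ∈ A := (hAB ▸ mem_univ p : p ∈ A ∪ B).resolve_right hp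
  have hqB : q ∈ B := (hAB ▸ mem_univ q : q ∈ A ∪ B).resolve_left hq
  refine not_isPreconnected_of_subset_higsonCorona_nat (A := Subtype.val '' A)
    (B := Subtype.val '' B) (p := p) (q := q) (hA.1.image continuous_subtype_val)
    (hB.1.image continuous_subtype_val) ?_ (mem_image_of_mem _ hpA) ?_ (mem_image_of_mem _ hqB) ?_
    (hA.2.isPreconnected.image _ continuous_subtype_val.continuousOn)
  · rw [← image_union, hAB, image_univ, Subtype.range_coe]
  · simpa using hp
  · simpa using hq

end HalfLine

/-! ### Chains, rays, and the decomposition when a ray is not coarsely dense. -/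

section Geodesic

/-- The graph whose edges are the steps of length at most `c`. -/
def stepGraph (X : Type u) [MetricSpace X] (c : ℝ) : SimpleGraph X where
  Adj x y := x ≠ y ∧ dist x y ≤ c
  symm := ⟨fun x y h => ⟨h.1.symm, by rw [dist_comm]; exact h.2⟩⟩
  loopless := ⟨fun _ h => h.1 rfl⟩

variable {X : Type u} [MetricSpace X] {c : ℝ}

theorem exists_walk_of_dist_le {x y : X} (h : dist x y ≤ c) :
    ∃ w : (stepGraph X c).Walk x y, w.length ≤ 1 := by
  by_cases hxy : x = y
  · subst hxy
    exact ⟨.nil, zero_le_one⟩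
  · exact ⟨.cons (show (stepGraph X c).Adj x y from ⟨hxy, h⟩) .nil, le_rfl⟩

theorem exists_walk_of_chain {p : ℕ → X} (n : ℕ) (h : ∀ i < n, dist (p i) (p (i + 1)) ≤ c) :
    ∃ w : (stepGraph X c).Walk (p 0) (p n), w.length ≤ n := by
  induction n with
  | zero => exact ⟨.nil, le_rfl⟩
  | succ n ih =>
    obtain ⟨w, hw⟩ := ih fun i hi => h i (hi.trans n.lt_succ_self)
    obtain ⟨w', hw'⟩ := exists_walk_of_dist_le (h n n.lt_succ_self)
    exact ⟨w.append w', by rw [SimpleGraph.Walk.length_append]; omega⟩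

theorem dist_le_of_walk {x y : X} (w : (stepGraph X c).Walk x y) : dist x y ≤ c * w.length := by
  induction w with
  | nil => simp
  | @cons x y z h w ih =>
    have h1 := dist_triangle x y z
    have h2 : dist x y ≤ c := h.2
    rw [SimpleGraph.Walk.length_cons]
    push_cast
    linarith

theorem reflTransGen_of_walk {x y : X} (w : (stepGraph X c).Walk x y) {S : Set X}
    (hS : ∀ v ∈ w.support, v ∈ S) : Relation.ReflTransGen (StepIn c S) x y := by
  induction w with
  | nil => exact .refl
  | @cons x y z h w ih =>
    rw [SimpleGraph.Walk.support_cons] at hS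
    exact .head ⟨h.2, hS x (by simp), hS y (by simp)⟩ (ih fun v hv => hS v (by simp [hv]))

/-- Points at distance at most `r` are joined by a uniformly bounded number of steps. -/
def IsChainControlled (X : Type u) [MetricSpace X] (c : ℝ) : Prop :=
  ∀ r : ℝ, ∃ N : ℕ, ∀ x y : X, dist x y ≤ r → ∃ w : (stepGraph X c).Walk x y, w.length ≤ N

theorem UniformlyExpansive.exists_dist_le {Y : Type v} [MetricSpace Y] {f : X → Y}
    (hf : UniformlyExpansive f) (r : ℝ) : ∃ s : ℝ, ∀ x y, dist x y ≤ r → dist (f x) (f y) ≤ s := by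
  obtain ⟨σ, hσ, hf⟩ := hf
  refine ⟨σ r.toNNReal, fun x y h => ?_⟩
  have h1 : nndist x y ≤ r.toNNReal := by
    rw [← NNReal.coe_le_coe, coe_nndist]
    exact h.trans (Real.le_coe_toNNReal r)
  rw [← coe_nndist, NNReal.coe_le_coe]
  exact (hf x y).trans (hσ h1)

/-- A geodesic from `f x` to `f y`, sampled at integer times capped at its length, is carried back
by `g` to steps of length at most `s`. One further step at each end, of length at most `C`, reaches
`x` and `y`. -/
theorem CoarselyGeodesic.exists_isChainControlled (h : CoarselyGeodesic X) :
    ∃ c : ℝ, 0 < c ∧ IsChainControlled X c := by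
  obtain ⟨M, _, hM, f, ⟨hf, -⟩, g, ⟨hg, -⟩, ⟨C, hC, hgf⟩, -⟩ := h
  obtain ⟨s, hs⟩ := hg.exists_dist_le 1
  refine ⟨max s C, lt_max_of_lt_right hC, fun r => ?_⟩
  obtain ⟨t, ht⟩ := hf.exists_dist_le r
  refine ⟨1 + ⌈t⌉₊ + 1, fun x y hxy => ?_⟩
  obtain ⟨γ, hγ0, hγ1, hγ⟩ := hM (f x) (f y)
  set D := dist (f x) (f y) with hD
  have hD0 : 0 ≤ D := dist_nonneg
  have hDt : D ≤ ⌈t⌉₊ := (ht x y hxy).trans (Nat.le_ceil t)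
  let p : ℕ → X := fun i => g (γ (min i D))
  have hp0 : p 0 = g (f x) := by simp [p, hD0, hγ0]
  have hpn : p ⌈t⌉₊ = g (f y) := by simp [p, hDt, hγ1]
  have hmem : ∀ i : ℕ, min (i : ℝ) D ∈ Icc 0 D := fun i =>
    ⟨le_min i.cast_nonneg hD0, min_le_right _ _⟩
  have hstep : ∀ i < ⌈t⌉₊, dist (p i) (p (i + 1)) ≤ max s C := by
    intro i _
    refine (hs _ _ ?_).trans (le_max_left _ _)
    rw [hγ _ (hmem i) _ (hmem (i + 1))]
    refine (abs_min_sub_min_le_max _ _ _ _).trans ?_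
    simp
  obtain ⟨w, hw⟩ := exists_walk_of_chain _ hstep
  obtain ⟨w₀, hw₀⟩ := exists_walk_of_dist_le (c := max s C) (x := x) (y := p 0) (by
    rw [hp0, dist_comm]; exact (hgf x).le.trans (le_max_right _ _))
  obtain ⟨w₁, hw₁⟩ := exists_walk_of_dist_le (c := max s C) (x := p ⌈t⌉₊) (y := y) (by
    rw [hpn]; exact (hgf y).le.trans (le_max_right _ _))
  exact ⟨(w₀.append w).append w₁, by simp only [SimpleGraph.Walk.length_append]; omega⟩

/-- The vertices of a shortest walk to a point at graph distance at least `n`, which exists since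
otherwise `X` would be a bounded, hence compact, set. Minimality forbids shortcuts between its
vertices. -/
theorem exists_walks_of_unbounded [ProperSpace X] [NoncompactSpace X] (hc : IsChainControlled X c)
    (o : X) (n : ℕ) : ∃ p : ℕ → X, p 0 = o ∧ (∀ i < n, dist (p i) (p (i + 1)) ≤ c) ∧
      ∀ i j, i ≤ j → j ≤ n → ∀ w : (stepGraph X c).Walk (p i) (p j), j ≤ i + w.length := by
  have hreach : ∀ x, (stepGraph X c).Reachable o x := fun x => by
    obtain ⟨N, hN⟩ := hc (dist o x)
    exact ⟨(hN o x le_rfl).choose⟩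
  obtain ⟨x, hx⟩ : ∃ x, n ≤ (stepGraph X c).dist o x := by
    by_contra hn
    push Not at hn
    refine NoncompactSpace.noncompact_univ ((isCompact_closedBall o (|c| * n)).of_isClosed_subset
      isClosed_univ fun x _ => ?_)
    obtain ⟨w, hw⟩ := (hreach x).exists_walk_length_eq_dist
    rw [Metric.mem_closedBall, dist_comm]
    refine (dist_le_of_walk w).trans (mul_le_mul (le_abs_self c) ?_ (by positivity) (abs_nonneg c))
    rw [hw]
    exact_mod_cast (hn x).le
  obtain ⟨w, hw⟩ := (hreach x).exists_walk_length_eq_dist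
  refine ⟨w.getVert, w.getVert_zero, fun i hi => (w.adj_getVert_succ (by omega)).2, ?_⟩
  intro i j hij hj v
  have h1 := (stepGraph X c).dist_le (((w.take i).append v).append (w.drop j))
  simp only [SimpleGraph.Walk.length_append, SimpleGraph.Walk.take_length,
    SimpleGraph.Walk.drop_length] at h1
  omega

/-- A coarsely embedded ray. -/
structure IsRay (c : ℝ) (R : ℕ → X) : Prop where
  step : ∀ i, dist (R i) (R (i + 1)) ≤ c
  proper : ∀ r : ℝ, ∃ N : ℕ, ∀ i j, dist (R i) (R j) ≤ r → j ≤ i + N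

/-- A limit of ever longer shortest walks: the `i`-th vertices stay in a compact ball, so they
converge along a non-principal ultrafilter. -/
theorem exists_isRay [ProperSpace X] [NoncompactSpace X] (hc0 : 0 ≤ c)
    (hc : IsChainControlled X c) : ∃ R : ℕ → X, IsRay c R := by
  obtain ⟨o, -⟩ : (univ : Set X).Nonempty := nonempty_iff_ne_empty.2 fun h =>
    NoncompactSpace.noncompact_univ (h ▸ isCompact_empty)
  choose p hp0 hp1 hp2 using exists_walks_of_unbounded hc o
  have hball : ∀ i n, i ≤ n → dist (p n i) o ≤ c * i := by
    intro i n hin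
    obtain ⟨w, hw⟩ := exists_walk_of_chain (c := c) (p := p n) i fun j hj => hp1 n j (by omega)
    rw [← hp0 n, dist_comm]
    exact (dist_le_of_walk w).trans (mul_le_mul_of_nonneg_left (by exact_mod_cast hw) hc0)
  have hlim : ∀ i, ∃ x, Tendsto (fun n => p n i) (hyperfilter ℕ) (𝓝 x) := by
    intro i
    obtain ⟨x, -, hx⟩ := (isCompact_closedBall o (c * i)).ultrafilter_le_nhds
      ((hyperfilter ℕ).map fun n => p n i) (by
        rw [le_principal_iff, Ultrafilter.mem_coe, Ultrafilter.mem_map]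
        exact Nat.hyperfilter_le_atTop ((eventually_ge_atTop i).mono fun n hn => hball i n hn))
    exact ⟨x, hx⟩
  choose R hR using hlim
  refine ⟨R, fun i => ?_, fun r => ?_⟩
  · refine le_of_tendsto ((hR i).dist (hR (i + 1))) ?_
    filter_upwards [Nat.hyperfilter_le_atTop (eventually_gt_atTop i)] with n hn using hp1 n i hn
  -- A limit distance of at most `r` only yields distances below `r + 1` for the approximating
  -- walks.
  · obtain ⟨N, hN⟩ := hc (r + 1)
    refine ⟨N, fun i j hij => ?_⟩
    rcases le_total j i with h | h
    · omega
    have h1 := ((hR i).dist (hR j)).eventually_lt_const (show _ < r + 1 by linarith)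
    obtain ⟨n, hn1, hn2⟩ := (h1.and (Nat.hyperfilter_le_atTop (eventually_ge_atTop j))).exists
    obtain ⟨w, hw⟩ := hN _ _ hn1.le
    have := hp2 n i j h hn2 w
    omega

variable {R : ℕ → X}

theorem IsRay.dist_add_le (hR : IsRay c R) (i k : ℕ) : dist (R i) (R (i + k)) ≤ c * k := by
  induction k with
  | zero => simp
  | succ k ih =>
    have h1 := dist_triangle (R i) (R (i + k)) (R (i + (k + 1)))
    have h2 := hR.step (i + k)
    rw [add_assoc] at h2
    push_cast
    linarith

theorem IsRay.exists_notMem (hR : IsRay c R) {B : Set X} (hB : IsBounded B) :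
    ∃ n, ∀ i, n ≤ i → R i ∉ B := by
  obtain ⟨s, hs⟩ := (Metric.isBounded_iff_subset_closedBall (R 0)).1 hB
  obtain ⟨N, hN⟩ := hR.proper s
  refine ⟨N + 1, fun i hi h => ?_⟩
  have := hN 0 i (by rw [dist_comm]; exact hs h)
  omega

theorem IsRay.isCoarseDenseEmbedding (hR : IsRay c R) (hc : 0 ≤ c) {C : ℝ}
    (hC : ∀ x, ∃ i, dist (R i) x ≤ C) : IsCoarseDenseEmbedding R where
  continuous := continuous_of_discreteTopology
  expansive r := by
    refine ⟨c * r, ?_⟩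
    have key : ∀ i j : ℕ, i ≤ j → dist i j ≤ r → dist (R i) (R j) ≤ c * r := by
      intro i j hij h
      obtain ⟨k, rfl⟩ := Nat.exists_eq_add_of_le hij
      refine (hR.dist_add_le i k).trans (mul_le_mul_of_nonneg_left ?_ hc)
      rw [nat_dist_eq] at h
      push_cast at h
      simpa using h
    intro i j h
    rcases le_total i j with hij | hij
    · exact key i j hij h
    · rw [dist_comm]
      exact key j i hij (by rwa [dist_comm])
  proper r := by
    obtain ⟨N, hN⟩ := hR.proper r
    refine ⟨N, fun i j h => ?_⟩
    have h1 : (j : ℝ) ≤ i + N := by exact_mod_cast hN i j h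
    have h2 : (i : ℝ) ≤ j + N := by exact_mod_cast hN j i (by rwa [dist_comm])
    rw [nat_dist_eq, abs_le]
    constructor <;> linarith
  dense := ⟨C, hC⟩

theorem IsRay.reflTransGen (hR : IsRay c R) {S : Set X} {n : ℕ} (hS : ∀ i, n ≤ i → R i ∈ S)
    {i : ℕ} (hi : n ≤ i) : Relation.ReflTransGen (StepIn c S) (R n) (R i) := by
  induction i, hi using Nat.le_induction with
  | base => exact .refl
  | succ i hi ih => exact ih.tail ⟨hR.step i, hS i hi, hS _ (hi.trans i.le_succ)⟩

/-- If the corona is connected, then far away points are joined to the ray far away. -/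
theorem IsRay.exists_reflTransGen [ProperSpace X] (hR : IsRay c R) (hc0 : 0 ≤ c)
    (hc : IsChainControlled X c) (hX : IsPreconnected (higsonCorona X)) (o : X) (m : ℝ) :
    ∃ M : ℝ, ∀ x, M < dist x o → x ∉ Metric.closedBall o m ∧
      ∃ i, Relation.ReflTransGen (StepIn c (Metric.closedBall o m)ᶜ) x (R i) := by
  obtain ⟨n, hn⟩ := hR.exists_notMem (Metric.isBounded_closedBall (x := o) (r := m))
  set S := (Metric.closedBall o m)ᶜ with hS
  set U : Set X := {x | x ∈ S ∧ Relation.ReflTransGen (StepIn c S) x (R n)}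
  set W : Set X := {x | x ∈ S ∧ ¬ Relation.ReflTransGen (StepIn c S) x (R n)}
  have hU : ¬ IsBounded U := by
    intro h
    obtain ⟨n', hn'⟩ := hR.exists_notMem h
    exact hn' (max n n') (le_max_right _ _) ⟨hn _ (le_max_left _ _),
      reflTransGen_stepIn_symm (hR.reflTransGen hn (le_max_left _ _))⟩
  have hW : IsBounded W := by
    by_contra hW
    -- A walk of at most `N` steps starting farther than `m + c * N` from `o` cannot enter the ball
    -- of radius `m`, so its endpoints are joined outside that ball.
    have hdiv : Divergent U W := by
      intro r
      obtain ⟨N, hN⟩ := hc r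
      refine (Metric.isBounded_closedBall (x := o) (r := m + c * N)).subset ?_
      rintro a ⟨⟨ha, haR⟩, b, ⟨hb, hbR⟩, hab⟩
      by_contra hfar
      rw [Metric.mem_closedBall, not_le] at hfar
      obtain ⟨w, hw⟩ := hN a b hab
      refine hbR ((reflTransGen_stepIn_symm (reflTransGen_of_walk w fun v hv => ?_)).trans haR)
      classical
      have h1 := dist_le_of_walk (w.takeUntil v hv)
      have h2 : ((w.takeUntil v hv).length : ℝ) ≤ N := by
        exact_mod_cast (w.length_takeUntil_le_length hv).trans hw
      have h3 := mul_le_mul_of_nonneg_left h2 hc0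
      have h4 := dist_triangle a v o
      rw [hS, mem_compl_iff, Metric.mem_closedBall, not_le]
      linarith
    have hcov : trace (univ : Set X) ⊆ trace U ∪ trace W := by
      intro z hz
      obtain ⟨F, hF1, -, hF3⟩ := mem_trace_iff.1 hz
      rw [← trace_union]
      refine mem_trace_iff.2 ⟨F, hF1, ?_, hF3⟩
      filter_upwards [hF1 (isBounded_def.1 (Metric.isBounded_closedBall (x := o) (r := m)))]
        with x hx
      by_cases h : Relation.ReflTransGen (StepIn c S) x (R n)
      · exact Or.inl ⟨hx, h⟩
      · exact Or.inr ⟨hx, h⟩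
    rw [higsonCorona_eq_trace] at hX
    obtain ⟨z, -, hz1, hz2⟩ := isPreconnected_closed_iff.1 hX _ _ (isClosed_trace U)
      (isClosed_trace W) hcov
      ((trace_nonempty hU).mono fun z hz => ⟨trace_mono (subset_univ _) hz, hz⟩)
      ((trace_nonempty hW).mono fun z hz => ⟨trace_mono (subset_univ _) hz, hz⟩)
    exact disjoint_left.1 hdiv.disjoint_trace hz1 hz2
  obtain ⟨s, hs⟩ := (Metric.isBounded_iff_subset_closedBall o).1 hW
  refine ⟨max m s, fun x hx => ?_⟩
  have hxm : x ∈ S := by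
    rw [hS, mem_compl_iff, Metric.mem_closedBall, not_le]
    exact (le_max_left _ _).trans_lt hx
  refine ⟨hxm, n, ?_⟩
  by_contra h
  have := hs (show x ∈ W from ⟨hxm, h⟩)
  rw [Metric.mem_closedBall] at this
  exact absurd hx (not_lt.2 (this.trans (le_max_right _ _)))

/-- The vertices of the chain serve as `T`; finiteness makes the appendices built from such chains
bounded. -/
theorem exists_finite_chain {S : Set X} {x y : X} (hy : y ∈ S)
    (h : Relation.ReflTransGen (StepIn c S) x y) :
    ∃ T ⊆ S, T.Finite ∧ x ∈ T ∧ y ∈ T ∧ ∀ t ∈ T, Relation.ReflTransGen (StepIn c T) t y := by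
  induction h using Relation.ReflTransGen.head_induction_on with
  | refl => exact ⟨{y}, by simpa using hy, finite_singleton y, rfl, rfl, by
      rintro t rfl; exact .refl⟩
  | @head x z hxz _ ih =>
    obtain ⟨T, hTS, hTf, hzT, hyT, hT⟩ := ih
    refine ⟨insert x T, insert_subset hxz.2.1 hTS, hTf.insert x, mem_insert _ _,
      mem_insert_of_mem _ hyT, ?_⟩
    have hmono : ∀ t ∈ T, Relation.ReflTransGen (StepIn c (insert x T)) t y := fun t ht =>
      reflTransGen_stepIn_mono (subset_insert _ _) (hT t ht)
    rintro t (rfl | ht)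
    · exact .head ⟨hxz.1, mem_insert _ _, mem_insert_of_mem _ hzT⟩ (hmono z hzT)
    · exact hmono t ht

/-- Far from a ray that is not coarsely dense, there are bounded sets that contain large balls and
are joined to the ray far away. -/
theorem IsRay.exists_appendix [ProperSpace X] (hR : IsRay c R) (hc0 : 0 ≤ c)
    (hc : IsChainControlled X c) (hX : IsPreconnected (higsonCorona X))
    (hd : ∀ C : ℝ, ∃ x, ∀ i, C < dist (R i) x) (o : X) (n : ℕ) (m : ℝ) :
    ∃ (x : X) (T : Set X) (M : ℝ), T ⊆ Metric.closedBall o M ∧ Disjoint T (Metric.closedBall o m) ∧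
      x ∈ T ∧ (∀ i, (n : ℝ) < dist (R i) x) ∧
      (∀ y, ∀ w : (stepGraph X c).Walk x y, w.length ≤ n → y ∈ T) ∧
      ∃ i, R i ∈ T ∧ ∀ t ∈ T, Relation.ReflTransGen (StepIn c T) t (R i) := by
  obtain ⟨M, hM⟩ := hR.exists_reflTransGen hc0 hc hX o m
  -- Adding `dist (R 0) o` turns distance from the ray into distance from `o`: far enough to be
  -- joined to the ray, and for `n` steps from `x` to avoid the `m`-ball.
  obtain ⟨x, hx⟩ := hd (max n (max M (m + c * n) + dist (R 0) o))
  have hxn : ∀ i, (n : ℝ) < dist (R i) x := fun i => (le_max_left _ _).trans_lt (hx i)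
  have hxo : max M (m + c * n) < dist x o := by
    have h1 := (le_max_right _ _).trans_lt (hx 0)
    have h2 := dist_triangle_right (R 0) x o
    linarith
  obtain ⟨hxm, i, hi⟩ := hM x ((le_max_left _ _).trans_lt hxo)
  have hiS : R i ∈ (Metric.closedBall o m)ᶜ := by
    rcases Relation.ReflTransGen.cases_tail hi with h | ⟨_, _, h⟩
    · rw [h]; exact hxm
    · exact h.2.2
  obtain ⟨T, hTS, hTf, hxT, hiT, hT⟩ := exists_finite_chain hiS hi
  set V : Set X := {y | ∃ w : (stepGraph X c).Walk x y, w.length ≤ n}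
  have hV : ∀ y ∈ V, dist x y ≤ c * n := by
    rintro y ⟨w, hw⟩
    exact (dist_le_of_walk w).trans (mul_le_mul_of_nonneg_left (by exact_mod_cast hw) hc0)
  have hVb : IsBounded V := (Metric.isBounded_closedBall (x := x) (r := c * n)).subset
    fun y hy => by rw [Metric.mem_closedBall, dist_comm]; exact hV y hy
  obtain ⟨M', hM'⟩ := (Metric.isBounded_iff_subset_closedBall o).1 (hVb.union hTf.isBounded)
  refine ⟨x, V ∪ T, M', hM', ?_, Or.inr hxT, hxn, fun y w hw => Or.inl ⟨w, hw⟩, i, Or.inr hiT, ?_⟩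
  · rw [disjoint_union_left]
    refine ⟨disjoint_left.2 fun y hy hyo => ?_, disjoint_left.2 fun y hy => hTS hy⟩
    have h1 := hV y hy
    have h2 := (le_max_right _ _).trans_lt hxo
    have h3 := dist_triangle x y o
    rw [Metric.mem_closedBall] at hyo
    linarith
  · have hTV : ∀ t ∈ T, Relation.ReflTransGen (StepIn c (V ∪ T)) t (R i) := fun t ht =>
      reflTransGen_stepIn_mono subset_union_right (hT t ht)
    rintro t (⟨w, hw⟩ | ht)
    · refine (reflTransGen_stepIn_symm (reflTransGen_of_walk w fun v hv => ?_)).trans (hTV x hxT)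
      classical
      exact Or.inl ⟨w.takeUntil v hv, (w.length_takeUntil_le_length hv).trans hw⟩
    · exact hTV t ht

theorem divergent_image_of_eventually {x : ℕ → X} {I : Set ℕ} {S : Set X}
    (h : ∀ r : ℝ, ∃ K : ℕ, ∀ k ∈ I, K ≤ k → ∀ y ∈ S, r < dist (x k) y) :
    Divergent (x '' I) S := by
  intro r
  obtain ⟨K, hK⟩ := h r
  refine ((finite_Iio K).image x).isBounded.subset ?_
  rintro _ ⟨⟨k, hk, rfl⟩, y, hy, hd⟩
  refine mem_image_of_mem _ (mem_Iio.2 (not_le.1 fun hle => ?_))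
  exact absurd hd (not_le.2 (hK k hk hle y hy))

/-- In a space with indecomposable corona, rays are coarsely dense. -/
theorem IsRay.exists_dist_le [ProperSpace X] (hR : IsRay c R) (hc0 : 0 ≤ c)
    (hc : IsChainControlled X c) (hX : IsIndecomposableContinuum (higsonCorona X)) :
    ∃ C : ℝ, ∀ x, ∃ i, dist (R i) x ≤ C := by
  by_contra hd
  push Not at hd
  set o := R 0
  have hconn := isContinuum_higsonCorona_iff.1 hX.1
  choose x T M hTM hTm hxT hxR hT i hiT hTi using
    hR.exists_appendix hc0 hc hconn.isPreconnected hd o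
  -- The radius `m (k + 1)` encloses the `k`-th appendix, so later ones are disjoint from it; the `+
  -- 1` pushes them to infinity.
  let m : ℕ → ℝ := fun k => Nat.rec 0 (fun k a => max (M k a) (a + 1)) k
  have hms : ∀ k, m (k + 1) = max (M k (m k)) (m k + 1) := fun _ => rfl
  have hmono : Monotone m := monotone_nat_of_le_succ fun k => by
    rw [hms]; exact (by linarith : m k ≤ m k + 1).trans (le_max_right _ _)
  have hmk : ∀ k : ℕ, (k : ℝ) ≤ m k := by
    intro k
    induction k with
    | zero => simp [m]
    | succ k ih => rw [hms]; push_cast; exact le_max_of_le_right (by linarith)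
  let P : ℕ → Set X := fun k => T k (m k)
  let y : ℕ → X := fun k => x k (m k)
  have hPb : ∀ k, P k ⊆ Metric.closedBall o (m (k + 1)) := fun k =>
    (hTM k (m k)).trans (Metric.closedBall_subset_closedBall (by rw [hms]; exact le_max_left _ _))
  have hPd : ∀ j k, j ≠ k → Disjoint (P j) (P k) := by
    have : ∀ j k, j < k → Disjoint (P j) (P k) := fun j k hjk =>
      ((hTm k (m k)).mono_right ((hPb j).trans
        (Metric.closedBall_subset_closedBall (hmono hjk)))).symm
    intro j k hjk
    rcases lt_or_gt_of_ne hjk with h | h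
    · exact this j k h
    · exact (this k j h).symm
  have hPfar : ∀ B : Set X, IsBounded B → ∃ k0, ∀ k, k0 ≤ k → Disjoint (P k) B := by
    intro B hB
    obtain ⟨s, hs⟩ := (Metric.isBounded_iff_subset_closedBall o).1 hB
    obtain ⟨k0, hk0⟩ := exists_nat_ge s
    refine ⟨k0, fun k hk => (hTm k (m k)).mono_right (hs.trans
      (Metric.closedBall_subset_closedBall (hk0.trans (le_trans ?_ (hmk k)))))⟩
    exact_mod_cast hk
  have hyunb : ∀ I : Set ℕ, (∀ n, ∃ k ∈ I, n ≤ k) → ¬ IsBounded (y '' I) := by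
    intro I hI hb
    obtain ⟨k0, hk0⟩ := hPfar _ hb
    obtain ⟨k, hk, hkk⟩ := hI k0
    exact disjoint_left.1 (hk0 k hkk) (hxT k (m k)) (mem_image_of_mem _ hk)
  have hwalk : ∀ r : ℝ, ∃ K : ℕ, ∀ k, K ≤ k → ∀ z, dist (y k) z ≤ r → z ∈ P k := by
    intro r
    obtain ⟨N, hN⟩ := hc r
    refine ⟨N, fun k hk z hz => ?_⟩
    obtain ⟨w, hw⟩ := hN _ _ hz
    exact hT k (m k) z w (hw.trans hk)
  -- The ray with the even appendices. Large balls about the odd `y k` miss it, and large balls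
  -- about the even `y k` lie inside it.
  set A : Set X := range R ∪ ⋃ k ∈ {k : ℕ | Even k}, P k with hA
  have hPA : ∀ k, Even k → P k ⊆ A := fun k hk =>
    (subset_biUnion_of_mem (u := P) (show k ∈ {k : ℕ | Even k} from hk)).trans subset_union_right
  have hodd : Divergent (y '' {k | Odd k}) A := by
    refine divergent_image_of_eventually fun r => ?_
    obtain ⟨K, hK⟩ := hwalk r
    obtain ⟨r', hr'⟩ := exists_nat_ge r
    refine ⟨max K r', fun k hk hKk z hz => ?_⟩
    by_contra hle
    rw [not_lt] at hle
    rcases hz with ⟨j, rfl⟩ | hz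
    · have h1 := hxR k (m k) j
      have h2 : (r' : ℝ) ≤ k := by exact_mod_cast (le_max_right _ _).trans hKk
      rw [dist_comm] at h1
      linarith
    · obtain ⟨j, hj, hzj⟩ := mem_iUnion₂.1 hz
      have hjk : j ≠ k := fun h => Nat.not_even_iff_odd.2 hk (h ▸ hj)
      exact disjoint_left.1 (hPd j k hjk) hzj (hK k ((le_max_left _ _).trans hKk) z hle)
  have heven : Divergent (y '' {k | Even k}) Aᶜ := by
    refine divergent_image_of_eventually fun r => ?_
    obtain ⟨K, hK⟩ := hwalk r
    refine ⟨K, fun k hk hKk z hz => ?_⟩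
    by_contra hle
    rw [not_lt] at hle
    exact hz (hPA k hk (hK k hKk z hle))
  have hnot : ∀ (I : Set ℕ) (S : Set X), (∀ n, ∃ k ∈ I, n ≤ k) → Divergent (y '' I) S →
      ¬ trace univ ⊆ trace S := by
    intro I S hI hdiv hsub
    obtain ⟨z, hz⟩ := trace_nonempty (hyunb I hI)
    exact disjoint_left.1 hdiv.disjoint_trace hz (hsub (trace_mono (subset_univ _) hz))
  refine hX.2 (isDecomposable_higsonCorona hX.1 (A := A) ⟨trace_nonempty fun hb => ?_, ?_⟩
    (hnot _ _ (fun n => ⟨2 * n + 1, odd_two_mul_add_one n, by omega⟩) hodd)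
    (hnot _ _ (fun n => ⟨2 * n, even_two_mul n, by omega⟩) heven))
  · obtain ⟨n, hn⟩ := hR.exists_notMem hb
    exact hn n le_rfl (Or.inl (mem_range_self n))
  · refine isPreconnected_trace (c := c) fun B hB => ?_
    obtain ⟨n, hn⟩ := hR.exists_notMem hB
    have hB1 : IsBounded (B ∪ R '' Iio n) := hB.union ((finite_Iio n).image R).isBounded
    obtain ⟨k0, hk0⟩ := hPfar _ hB1
    -- Discarding an initial piece of the ray and finitely many appendices leaves each remaining
    -- appendix disjoint from `B` and attached to the ray at an index at least `n`.
    have hjoin : ∀ z ∈ A \ ((B ∪ R '' Iio n) ∪ ⋃ k ∈ Iio k0, P k),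
        Relation.ReflTransGen (StepIn c (A \ B)) (R n) z := by
      have hRz : ∀ j, n ≤ j → Relation.ReflTransGen (StepIn c (A \ B)) (R n) (R j) := fun j hj =>
        hR.reflTransGen (S := A \ B) (fun j hj => ⟨Or.inl (mem_range_self j), hn j hj⟩) hj
      have hge : ∀ j, R j ∉ B ∪ R '' Iio n → n ≤ j := fun j hj =>
        not_lt.1 fun h => hj (Or.inr (mem_image_of_mem _ h))
      rintro z ⟨hzA, hzB⟩
      rw [mem_union, not_or] at hzB
      rcases hzA with ⟨j, rfl⟩ | hz
      · exact hRz j (hge j hzB.1)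
      · obtain ⟨k, hk, hzk⟩ := mem_iUnion₂.1 hz
        have hkk : k0 ≤ k := not_lt.1 fun h => hzB.2 (mem_iUnion₂.2 ⟨k, h, hzk⟩)
        have hdis := hk0 k hkk
        refine (hRz (i k (m k)) (hge _ (disjoint_left.1 hdis (hiT k (m k))))).trans
          (reflTransGen_stepIn_symm (reflTransGen_stepIn_mono (T := A \ B)
            (fun t ht => ⟨hPA k hk ht, fun h => disjoint_left.1 hdis ht (Or.inl h)⟩)
            (hTi k (m k) z hzk)))
    refine ⟨_, hB1.union ((isBounded_biUnion (finite_Iio k0)).2 fun k _ =>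
      Metric.isBounded_closedBall.subset (hPb k)), fun u hu v hv => ?_⟩
    exact (reflTransGen_stepIn_symm (hjoin u hu)).trans (hjoin v hv)

end Geodesic

end Coarse

theorem corollary3p11 {X : Type*} [MetricSpace X] [ProperSpace X] [NoncompactSpace X]
    (hgeod : Coarse.CoarselyGeodesic X) (hbg : Coarse.CoarseBoundedGeometry X) :
    Coarse.IsIndecomposableContinuum (Coarse.higsonCorona X) ↔
      Nonempty (Coarse.higsonCorona X ≃ₜ Coarse.higsonCorona ℕ) := by
  constructor
  · intro h
    obtain ⟨c, hc0, hc⟩ := hgeod.exists_isChainControlled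
    obtain ⟨R, hR⟩ := Coarse.exists_isRay hc0.le hc
    obtain ⟨C, hC⟩ := hR.exists_dist_le hc0.le hc h
    exact (hR.isCoarseDenseEmbedding hc0.le hC).nonempty_homeomorph.map Homeomorph.symm
  · rintro ⟨e⟩
    exact Coarse.isIndecomposableContinuum_of_homeomorph e.symm
      Coarse.isIndecomposableContinuum_higsonCorona_nat
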